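/- Consider a supercritical branching random walk on $\mathbb{R}$ defined on a probability space $(\Omega,\mathcal{A},\mathbb{P})$: let $\mathcal{Z}(u)=\sum_{j=1}^{N(u)}\delta_{X_j(u)}$, $u\in\bigcup_{n\ge0}\mathbb{N}^n$, be i.i.d. copies of a point process $\mathcal{Z}=\mathcal{Z}(\varnothing)$ on $\mathbb{R}$ with $N=\mathcal{Z}(\mathbb{R})<\infty$ and $\mathbb{E}[N]\in(1,\infty]$, where the enumerations $(X_j(u))_{1\le j\le N(u)}$ are independent for different $u$. Put $\mathcal{G}_0=\{\varnothing\}$, $\mathcal{G}_{n+1}=\{uj: u\in\mathcal{G}_n,\ 1\le j\le N(u)\}$, $S(\varnothing)=0$ and $S(uj)=S(u)+X_j(u)$. Let $\mu$ be the intensity measure of $\mathcal{Z}$, let $\mathcal{D}$ be the set of $\lambda\in\mathbb{C}$ for which $m(\lambda)=\int_{\mathbb{R}} e^{-\lambda x}\,\mu(\mathrm{d}x)$ converges absolutely, and for $\lambda\in\mathcal{D}$ with $m(\lambda)\neq0$ let $$Z_n(\lambda)=\frac1{m(\lambda)^n}\sum_{u\in\mathcal{G}_n}e^{-\lambda S(u)},\qquad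 n\ge0 .$$ Suppose that $\lambda\in\mathcal{D}$ with $\theta=\mathrm{Re}(\lambda)$ satisfies, for some $\alpha\in(1,2)$, $$\frac{m(\alpha\theta)}{|m(\lambda)|^\alpha}=1\qquad\text{and}\qquad\frac{\theta\, m'(\alpha\theta)}{|m(\lambda)|^\alpha}\le\log|m(\lambda)| .$$ (The first condition includes $\alpha\theta\in\mathcal{D}$ and $m(\lambda)\ne0$. In the second, $m'(\alpha\theta)$ is the finite derivative at $\alpha\theta$ of $m$ restricted to $\mathcal{D}\cap\mathbb{R}$, hence one-sided if $\alpha\theta$ is an endpoint of this interval, and it is assumed to exist; if $\theta=0$, then $\theta\,m'(\alpha\theta)$ is read as $0$ and nothing is assumed about $m'$.) Suppose in addition that $\mathbb{E}[|Z_1(\lambda)|^\gamma]<\infty$ for some $\gamma\in(\alpha,2]$. Then there is a complex random variable $Z(\lambda)$ such that $Z_n(\lambda)\to Z(\lambda)$ almost surely and in $L^p$ for every $0<p<\alpha$ (in particular $\mathbb{E}[|Z_n(\lambda)|^p]<\infty$ for all $n$ and $\mathbb{E}[|Z(\lambda)|^p]<\infty$). Moreover, there is a constant $C>0$ such that $$\mathbb{P}(|Z(\lambda)|\ge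 t)\le C\,t^{-\alpha}\qquad\text{for all } t>0 .$$ -/

import Mathlib

open MeasureTheory ProbabilityTheory Filter Topology
open scoped ENNReal

noncomputable section

/-- The finite point measure `∑_{j < n} δ_{x_j}` carried by a finite sequence of reals. -/
def pointMeasure (c : Σ n : ℕ, Fin n → ℝ) : Measure ℝ :=
  ∑ j : Fin c.1, Measure.dirac (c.2 j)

/-- A supercritical branching random walk on `(Ω, P)`.

Individuals are words over the alphabet `ℕ` (Ulam-Harris labels). A word is stored with its last
letter first: the ancestor is `[]`, and child `j` of `u` is `j :: u`; children are numbered from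
`0`. `offspring u ω` is the finite sequence `(X_j(u))_{j < N(u)}` of displacements of the
children of `u` relative to `u`; the reproduction point process of `u` is
`𝒵(u) = ∑_{j < N(u)} δ_{X_j(u)}`. -/
structure BranchingRandomWalk {Ω : Type*} [MeasurableSpace Ω] (P : Measure Ω) where
  /-- The displacements of the children of each potential individual. -/
  offspring : List ℕ → Ω → Σ n : ℕ, Fin n → ℝ
  measurable_offspring : ∀ u, Measurable (offspring u)
  /-- Different individuals reproduce independently. -/
  iIndepFun_offspring : iIndepFun offspring P
  /-- The point processes `𝒵(u)` are copies of `𝒵 = 𝒵(∅)` (equality of laws of random measures). -/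
  identDistrib_pointMeasure : ∀ u, IdentDistrib (fun ω => pointMeasure (offspring u ω))
    (fun ω => pointMeasure (offspring [] ω)) P P
  /-- Supercriticality: `E[N] > 1` (the value `∞` is allowed). -/
  supercritical : 1 < ∫⁻ ω, ((offspring [] ω).1 : ℝ≥0∞) ∂P

namespace BranchingRandomWalk

variable {Ω : Type*} [MeasurableSpace Ω] {P : Measure Ω} (B : BranchingRandomWalk P)

/-- The number `N(u)` of children of `u`. -/
def numChildren (u : List ℕ) (ω : Ω) : ℕ := (B.offspring u ω).1

/-- The displacement `X_j(u)` of child `j` of `u`; it is only used for `j < N(u)`. -/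
def displacement (u : List ℕ) (j : ℕ) (ω : Ω) : ℝ :=
  if h : j < (B.offspring u ω).1 then (B.offspring u ω).2 ⟨j, h⟩ else 0

/-- The set `𝒢_n` of individuals of generation `n`. -/
def generation : ℕ → Ω → Finset (List ℕ)
  | 0, _ => {[]}
  | n + 1, ω => (generation n ω).biUnion fun u =>
      (Finset.range (B.numChildren u ω)).image fun j => j :: u

/-- The position `S(u)` of the individual `u`. -/
def position : List ℕ → Ω → ℝ
  | [], _ => 0
  | j :: u, ω => position u ω + B.displacement u j ω

/-- The intensity measure `μ(A) = E[𝒵(A)]` of the reproduction point process. -/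
def intensity : Measure ℝ := P.bind fun ω => pointMeasure (B.offspring [] ω)

/-- The set `𝒟` of all complex `z` for which `∫ e^{-z x} μ(dx)` converges absolutely. -/
def domain : Set ℂ := {z | Integrable (fun x : ℝ => Complex.exp (-z * x)) B.intensity}

/-- The Laplace transform `m(z) = ∫ e^{-z x} μ(dx)` of the intensity measure, for `z ∈ 𝒟`. -/
def m (z : ℂ) : ℂ := ∫ x : ℝ, Complex.exp (-z * x) ∂B.intensity

/-- The set `𝒟 ∩ ℝ` of all real `s` with `m(s) < ∞`. -/
def realDomain : Set ℝ := {s | Integrable (fun x : ℝ => Real.exp (-s * x)) B.intensity}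

/-- The function `m` at real arguments, as a real-valued function. -/
def mReal (s : ℝ) : ℝ := ∫ x : ℝ, Real.exp (-s * x) ∂B.intensity

/-- The additive (Biggins) martingale `Z_n(z) = m(z)^{-n} ∑_{|u| = n} e^{-z S(u)}`. -/
def additiveMartingale (z : ℂ) (n : ℕ) (ω : Ω) : ℂ :=
  (B.m z ^ n)⁻¹ * ∑ u ∈ B.generation n ω, Complex.exp (-z * B.position u ω)

end BranchingRandomWalk

end

/-! Put ℓ = log|m(λ)| and V(u) = θS(u) + |u|ℓ, so that the summand of Z_n belonging to u has modulus
e^{-V(u)}. Then Z_n − 1 is the sum, over the individuals u of generations before n, of the weight of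
u times the centred fluctuation Z_1 − 1 of the reproduction of u. The condition m(αθ) = |m(λ)|^α
says that tilting the increments of V by e^{-αV} produces a probability law ν. Sums over the tree
weighted by e^{-αV} thus become expectations for a random walk with step law ν (`survivingSum_eq`).

Fix T ≥ 0 and cut every ancestral line at its first descent below −T. The probability that anything
is cut is at most e^{-αT} (`measure_exists_not_surviving_le`). If nothing is cut, Z_n − 1 equals the
truncated sum. By an inequality of von Bahr–Esseen type (`integral_norm_sum_rpow_le`), its γ-th
moment is at most a constant times the expected sum of e^{-γV} over the surviving individuals. That
sum is e^{(γ-α)T} times the Green function of the ν-walk started at T and killed below 0, applied to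
e^{-(γ-α)x}. This Green function is bounded in T whatever the drift (`exists_tsum_killedStep_le`);
supercriticality enters to exclude ν = δ_0 (`tiltedLaw_singleton_ne_one`). Chebyshev's inequality at
level e^T gives e^{-γT}e^{(γ-α)T} = e^{-αT}, hence a tail bound for Z_n − 1 uniform in n
(`exists_tail_bound`).

This bound controls all moments of order below α. As α > 1, the martingale is bounded in L^1 and
converges almost surely; uniformly bounded moments of a slightly larger order give L^p convergence,
and the tail bound passes to the limit (`exists_limit_of_tail`).

The Green function is bounded at 0 by comparison with the walk reflected at 0
(`sum_killedStep_zero_le`), then on some interval [0, a) (`exists_partialGreen_le`), and then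
everywhere by a renewal argument (`partialGreen_le_of_le`). -/

noncomputable section

/-! ### Green function of a random walk killed below zero -/

/-- One step of the random walk with step law `ν`, killed upon entering `(-∞, 0)`. -/
def killedStep (ν : Measure ℝ) (g : ℝ → ℝ≥0∞) (x : ℝ) : ℝ≥0∞ :=
  ∫⁻ y, (Set.Ici 0).indicator g (x + y) ∂ν

/-- One step of the random walk with step law `ν`, reflected at `0`. -/
def reflectedStep (ν : Measure ℝ) (g : ℝ → ℝ≥0∞) (x : ℝ) : ℝ≥0∞ :=
  ∫⁻ y, g (max (x + y) 0) ∂ν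

/-- The exponential weight `x ↦ e^{-cx}`. -/
def expWeight (c x : ℝ) : ℝ≥0∞ := ENNReal.ofReal (Real.exp (-(c * x)))

theorem killedStep_apply (ν : Measure ℝ) (g : ℝ → ℝ≥0∞) (x : ℝ) :
    killedStep ν g x = ∫⁻ y, (Set.Ici 0).indicator g (x + y) ∂ν := rfl

theorem reflectedStep_apply (ν : Measure ℝ) (g : ℝ → ℝ≥0∞) (x : ℝ) :
    reflectedStep ν g x = ∫⁻ y, g (max (x + y) 0) ∂ν := rfl

theorem measurable_expWeight (c : ℝ) : Measurable (expWeight c) := by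
  unfold expWeight; fun_prop

theorem expWeight_le_one {c x : ℝ} (h : 0 ≤ c * x) : expWeight c x ≤ 1 := by
  unfold expWeight
  rw [ENNReal.ofReal_le_one]
  exact Real.exp_le_one_iff.2 (by linarith)

theorem expWeight_add (c x y : ℝ) : expWeight c (x + y) = expWeight c x * expWeight c y := by
  unfold expWeight
  rw [← ENNReal.ofReal_mul (Real.exp_nonneg _), ← Real.exp_add]
  ring_nf

theorem measurable_killedStep (ν : Measure ℝ) [SFinite ν] {g : ℝ → ℝ≥0∞} (hg : Measurable g) :
    Measurable (killedStep ν g) := by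
  have : Measurable fun p : ℝ × ℝ => (Set.Ici 0).indicator g (p.1 + p.2) :=
    (hg.indicator measurableSet_Ici).comp measurable_add
  exact this.lintegral_prod_right'

theorem measurable_killedStep_iterate (ν : Measure ℝ) [SFinite ν] {g : ℝ → ℝ≥0∞}
    (hg : Measurable g) (n : ℕ) : Measurable ((killedStep ν)^[n] g) := by
  induction n with
  | zero => exact hg
  | succ n ih => rw [Function.iterate_succ_apply']; exact measurable_killedStep ν ih

section Green

variable {ν : Measure ℝ} [IsProbabilityMeasure ν] {c : ℝ}

omit [IsProbabilityMeasure ν] in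
theorem antitone_reflectedStep_iterate (hc : 0 ≤ c) (n : ℕ) :
    Antitone ((reflectedStep ν)^[n] (expWeight c)) := by
  induction n with
  | zero =>
    intro x y h
    apply ENNReal.ofReal_le_ofReal
    apply Real.exp_le_exp.2
    nlinarith
  | succ n ih =>
    rw [Function.iterate_succ_apply']
    intro x y h
    exact lintegral_mono fun s => ih (max_le_max_right 0 (by linarith))

/-- Drive two reflected walks from x and x + a by the same steps. As long as the lower one has not
been pushed up at 0, their distance is exactly a, and the weights differ by the factor 1 − e^{-ca}
times the weight of the killed walk. Afterwards only the order of the two walks is used. -/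
theorem reflectedStep_gap (hc : 0 ≤ c) {a : ℝ} (ha : 0 ≤ a) (n : ℕ) :
    ∀ x, 0 ≤ x → (reflectedStep ν)^[n] (expWeight c) (x + a) +
      (1 - expWeight c a) * (killedStep ν)^[n] (expWeight c) x ≤
        (reflectedStep ν)^[n] (expWeight c) x := by
  have h1 : expWeight c a ≤ 1 := expWeight_le_one (by positivity)
  induction n with
  | zero =>
    intro x hx
    simp only [Function.iterate_zero, id]
    rw [expWeight_add, mul_comm (1 - _), ← mul_add, add_tsub_cancel_of_le h1, mul_one]
  | succ n ih =>
    intro x hx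
    have hm := antitone_reflectedStep_iterate (ν := ν) hc n
    rw [Function.iterate_succ_apply', Function.iterate_succ_apply']
    rw [reflectedStep_apply, reflectedStep_apply, killedStep_apply]
    rw [← lintegral_const_mul, ← lintegral_add_left]
    · refine lintegral_mono fun y => ?_
      by_cases h : 0 ≤ x + y
      · have := ih (x + y) h
        rw [Set.indicator_of_mem (by exact h), max_eq_left h, max_eq_left (by linarith)]
        rwa [show x + a + y = x + y + a by ring]
      · rw [Set.indicator_of_notMem (by exact h), mul_zero, add_zero]
        exact hm (max_le_max_right 0 (by linarith))
    · exact hm.measurable.comp (by fun_prop)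
    · exact ((measurable_killedStep_iterate ν (measurable_expWeight c) n).indicator
        measurableSet_Ici).comp (by fun_prop)

/-- The first step takes the reflected walk from 0 to `max y 0`. Integrating `reflectedStep_gap` at
x = 0, a = `max y 0` bounds each term of the sum, multiplied by the prefactor, by the decrease of
the reflected expectation from n to n + 1; these decreases telescope from the initial value 1. -/
theorem sum_killedStep_zero_le (hc : 0 ≤ c) (N : ℕ) :
    (∫⁻ y, (1 - expWeight c (max y 0)) ∂ν) *
      ∑ n ∈ Finset.range N, (killedStep ν)^[n] (expWeight c) 0 ≤ 1 := by
  set w : ℕ → ℝ≥0∞ := fun n => (reflectedStep ν)^[n] (expWeight c) 0 with hw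
  have key : ∀ n, w (n + 1) + (∫⁻ y, (1 - expWeight c (max y 0)) ∂ν) *
      (killedStep ν)^[n] (expWeight c) 0 ≤ w n := by
    intro n
    have hm := antitone_reflectedStep_iterate (ν := ν) hc n
    have hme : Measurable fun y => 1 - expWeight c (max y 0) :=
      measurable_const.sub ((measurable_expWeight c).comp (by fun_prop))
    simp only [hw]
    rw [Function.iterate_succ_apply', ← lintegral_mul_const _ hme]
    simp only [reflectedStep_apply]
    have hmm : Measurable fun y : ℝ => (reflectedStep ν)^[n] (expWeight c) (max (0 + y) 0) :=
      hm.measurable.comp (by fun_prop)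
    rw [← lintegral_add_left hmm]
    calc _ ≤ ∫⁻ _, (reflectedStep ν)^[n] (expWeight c) 0 ∂ν := by
          refine lintegral_mono fun y => ?_
          have := reflectedStep_gap (ν := ν) hc (le_max_right y 0) n 0 le_rfl
          simpa using this
      _ = _ := by simp
  have h2 : w N + (∫⁻ y, (1 - expWeight c (max y 0)) ∂ν) *
      ∑ n ∈ Finset.range N, (killedStep ν)^[n] (expWeight c) 0 ≤ 1 := by
    induction N with
    | zero => simp [hw, expWeight]
    | succ N ih =>
      rw [Finset.sum_range_succ, mul_add, add_comm (_ * _), ← add_assoc]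
      exact (add_le_add_left (key N) _).trans ih
  exact le_add_self.trans h2

/-- Steps that keep the walk from x nonnegative do the same from y, and the shift changes the final
weight by exactly this factor. -/
theorem killedStep_le_exp_mul {x y : ℝ} (h : x ≤ y) (n : ℕ) :
    (killedStep ν)^[n] (expWeight c) x ≤
      expWeight c (x - y) * (killedStep ν)^[n] (expWeight c) y := by
  induction n generalizing x y with
  | zero =>
    simp only [Function.iterate_zero, id]
    rw [← expWeight_add]; simp
  | succ n ih =>
    rw [Function.iterate_succ_apply']
    simp only [killedStep_apply]
    rw [← lintegral_const_mul]
    · refine lintegral_mono fun s => ?_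
      by_cases hx : 0 ≤ x + s
      · rw [Set.indicator_of_mem (by exact hx),
          Set.indicator_of_mem (by simp only [Set.mem_Ici]; linarith)]
        convert ih (by linarith : x + s ≤ y + s) using 3
        ring
      · rw [Set.indicator_of_notMem (by exact hx)]; exact zero_le
    · exact ((measurable_killedStep_iterate ν (measurable_expWeight c) n).indicator
        measurableSet_Ici).comp (by fun_prop)

variable (ν c) in
/-- Partial sums of the expected exponentially weighted occupation of the killed walk. -/
def partialGreen (N : ℕ) (x : ℝ) : ℝ≥0∞ :=
  ∑ n ∈ Finset.range N, (killedStep ν)^[n] (expWeight c) x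

theorem measurable_partialGreen (N : ℕ) : Measurable (partialGreen ν c N) := by
  unfold partialGreen
  exact Finset.measurable_fun_sum _ fun n _ =>
    measurable_killedStep_iterate ν (measurable_expWeight c) n

theorem partialGreen_succ (N : ℕ) (x : ℝ) :
    partialGreen ν c (N + 1) x = expWeight c x + killedStep ν (partialGreen ν c N) x := by
  unfold partialGreen
  rw [Finset.sum_range_succ', add_comm]
  congr 1
  simp only [Function.iterate_succ_apply']
  simp only [killedStep_apply]
  rw [← lintegral_finsetSum]
  · refine lintegral_congr fun y => ?_
    by_cases h : x + y ∈ Set.Ici (0 : ℝ)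
    · simp only [Set.indicator_of_mem h]
    · simp only [Set.indicator_of_notMem h, Finset.sum_const_zero]
  · intro n _
    exact ((measurable_killedStep_iterate ν (measurable_expWeight c) n).indicator
        measurableSet_Ici).comp (by fun_prop)

/-- Run the walks from x and x + a with the same steps. While the lower one survives, the upper one
contributes e^{-ca} times as much. When the lower one is killed, the upper one is either killed too
or lies in [0, a), from where it contributes at most K. -/
theorem partialGreen_add_le {a : ℝ} {K : ℝ≥0∞}
    (hK : ∀ N x, 0 ≤ x → x < a → partialGreen ν c N x ≤ K) (N : ℕ) (x : ℝ) :
    (Set.Ici 0).indicator (partialGreen ν c N) (x + a) ≤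
      expWeight c a * (Set.Ici 0).indicator (partialGreen ν c N) x + K := by
  induction N generalizing x with
  | zero => rw [Set.indicator_apply]; simp [partialGreen]
  | succ N ih =>
    by_cases hxa : 0 ≤ x + a
    swap
    · rw [Set.indicator_of_notMem (by exact hxa)]; exact zero_le
    rw [Set.indicator_of_mem (by exact hxa)]
    by_cases hx : 0 ≤ x
    swap
    · exact (hK _ _ hxa (by linarith)).trans le_add_self
    rw [Set.indicator_of_mem (by exact hx), partialGreen_succ, partialGreen_succ, mul_add,
      ← expWeight_add, add_comm a x, add_assoc]
    refine add_le_add le_rfl ?_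
    simp only [killedStep_apply]
    have hm : Measurable fun y => (Set.Ici 0).indicator (partialGreen ν c N) (x + y) :=
      ((measurable_partialGreen N).indicator measurableSet_Ici).comp (by fun_prop)
    calc _ ≤ ∫⁻ y, (expWeight c a * (Set.Ici 0).indicator (partialGreen ν c N) (x + y) + K) ∂ν := by
          refine lintegral_mono fun y => ?_
          rw [add_right_comm]; exact ih _
      _ = _ := by
          rw [lintegral_add_right _ measurable_const, lintegral_const_mul _ hm, lintegral_const,
            measure_univ, mul_one]

/-- Moving up by a replaces a bound b by e^{-ca}b + K according to `partialGreen_add_le`. The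
constant is the fixed point of this map, so it propagates from [0, a) to all of [0, ∞). -/
theorem partialGreen_le_of_le {a : ℝ} (ha : 0 < a) (hc : 0 < c) {K : ℝ≥0∞}
    (hK : ∀ N x, 0 ≤ x → x < a → partialGreen ν c N x ≤ K) (N : ℕ) {x : ℝ} (hx : 0 ≤ x) :
    partialGreen ν c N x ≤ K * ENNReal.ofReal (1 - Real.exp (-(c * a)))⁻¹ := by
  have hlt : Real.exp (-(c * a)) < 1 := Real.exp_lt_one_iff.2 (by nlinarith)
  set r := (1 - Real.exp (-(c * a)))⁻¹ with hr
  have hr1 : Real.exp (-(c * a)) * r + 1 = r := by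
    rw [hr]; field_simp [(sub_pos.2 hlt).ne']; ring
  have hr0 : 0 ≤ r := inv_nonneg.2 (sub_pos.2 hlt).le
  have hle : 1 ≤ r := by rw [← hr1]; nlinarith [Real.exp_nonneg (-(c * a))]
  have hstep : expWeight c a * (K * ENNReal.ofReal r) + K = K * ENNReal.ofReal r := by
    unfold expWeight
    nth_rw 2 [← hr1]
    rw [ENNReal.ofReal_add (by positivity) zero_le_one, ENNReal.ofReal_mul (Real.exp_nonneg _)]
    simp; ring
  have main : ∀ k : ℕ, ∀ x, 0 ≤ x → x < (k + 1) * a →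
      partialGreen ν c N x ≤ K * ENNReal.ofReal r := by
    intro k
    induction k with
    | zero =>
      intro x h0 h1
      refine (hK N x h0 (by simpa using h1)).trans ?_
      calc K = K * 1 := (mul_one _).symm
        _ ≤ _ := by gcongr; exact ENNReal.one_le_ofReal.2 hle
    | succ k ih =>
      intro x h0 h1
      push_cast at h1
      by_cases hxa : x < a
      · exact ih x h0 (by nlinarith [(Nat.cast_nonneg k : (0 : ℝ) ≤ k)])
      · push Not at hxa
        have := partialGreen_add_le hK N (x - a)
        rw [sub_add_cancel, Set.indicator_of_mem (by exact h0),
          Set.indicator_of_mem (by exact sub_nonneg.2 hxa)] at this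
        refine this.trans ?_
        rw [← hstep]
        gcongr
        exact ih _ (by linarith) (by linarith)
  obtain ⟨k, hk⟩ := exists_nat_gt (x / a)
  refine main k x hx ?_
  rw [div_lt_iff₀ ha] at hk
  linarith

/-- If ν does not charge (0, ∞), the walk in [0, a) can only move down, and for small a each step
kills it with probability bounded below. Otherwise the walk from 0 jumps to [a, ∞) with positive
probability for some a, so the bound at 0 controls the values there, and these control the values on
[0, a) through `killedStep_le_exp_mul`. -/
theorem exists_partialGreen_le (hc : 0 < c) (hν : ν {0} ≠ 1) :
    ∃ a, 0 < a ∧ ∃ K : ℝ≥0∞, K ≠ ⊤ ∧ ∀ N x, 0 ≤ x → x < a → partialGreen ν c N x ≤ K := by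
  by_cases hpos : ν (Set.Ioi 0) = 0
  · have hneg : ν (Set.Iio 0) ≠ 0 := by
      intro h0
      apply hν
      rw [prob_compl_eq_zero_iff (measurableSet_singleton _) |>.symm]
      have : ({0}ᶜ : Set ℝ) = Set.Iio 0 ∪ Set.Ioi 0 := by ext x; simp
      rw [this]
      exact measure_union_null h0 hpos
    have hex : ∃ n : ℕ, ν (Set.Iic (-(1 / ((n : ℝ) + 1)))) ≠ 0 := by
      by_contra! h
      apply hneg
      refine measure_mono_null ?_ (measure_iUnion_null h)
      intro x hx
      obtain ⟨n, hn⟩ := exists_nat_one_div_lt (show (0 : ℝ) < -x from neg_pos.2 hx)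
      exact Set.mem_iUnion.2 ⟨n, by simp only [Set.mem_Iic]; linarith⟩
    obtain ⟨n, hn⟩ := hex
    set a : ℝ := 1 / ((n : ℝ) + 1) with ha
    have ha0 : 0 < a := by positivity
    -- From a point below a, a step of at most −a kills, so survival has probability at most p =
    -- ν(−a, ∞), and the constant is the geometric series of p.
    refine ⟨a, ha0, (1 - ν (Set.Ioi (-a)))⁻¹, ?_, ?_⟩
    · rw [← Set.compl_Iic, prob_compl_eq_one_sub measurableSet_Iic,
        ENNReal.sub_sub_cancel ENNReal.one_ne_top prob_le_one]
      exact ENNReal.inv_ne_top.2 hn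
    set p := ν (Set.Ioi (-a)) with hp
    have hp1 : p < 1 := by
      rw [hp, ← Set.compl_Iic, prob_compl_eq_one_sub measurableSet_Iic]
      exact ENNReal.sub_lt_self ENNReal.one_ne_top one_ne_zero hn
    have hstep : 1 + (1 - p)⁻¹ * p = (1 - p)⁻¹ := by
      have h1 : (1 - p)⁻¹ * (1 - p) = 1 :=
        ENNReal.inv_mul_cancel (tsub_pos_of_lt hp1).ne' (by finiteness)
      nth_rw 1 [← h1]
      rw [← mul_add, tsub_add_cancel_of_le hp1.le, mul_one]
    intro N
    induction N with
    | zero => intro x _ _; simp [partialGreen]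
    | succ N ih =>
      intro x hx hxa
      rw [partialGreen_succ, ← hstep]
      refine add_le_add ?_ ?_
      · exact expWeight_le_one (by positivity)
      · simp only [killedStep_apply]
        calc _ ≤ ∫⁻ y, (Set.Ioi (-a)).indicator (fun _ => (1 - p)⁻¹) y ∂ν := by
              have hae : ∀ᵐ y ∂ν, y ∉ Set.Ioi (0 : ℝ) := measure_eq_zero_iff_ae_notMem.1 hpos
              refine lintegral_mono_ae (hae.mono fun y hy => ?_)
              simp only [Set.mem_Ioi, not_lt] at hy
              by_cases h : 0 ≤ x + y
              · rw [Set.indicator_of_mem (by exact h),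
                  Set.indicator_of_mem (by simp only [Set.mem_Ioi]; linarith)]
                exact ih _ h (by linarith)
              · rw [Set.indicator_of_notMem (by exact h)]; exact zero_le
          _ = _ := by rw [lintegral_indicator measurableSet_Ioi]; simp [hp]
  · have hex : ∃ n : ℕ, ν (Set.Ici (1 / ((n : ℝ) + 1))) ≠ 0 := by
      by_contra! h
      apply hpos
      refine measure_mono_null ?_ (measure_iUnion_null h)
      intro x hx
      obtain ⟨n, hn⟩ := exists_nat_one_div_lt (show (0 : ℝ) < x from hx)
      exact Set.mem_iUnion.2 ⟨n, hn.le⟩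
    obtain ⟨n, hn⟩ := hex
    set a : ℝ := 1 / ((n : ℝ) + 1) with ha
    have ha0 : 0 < a := by positivity
    set κ := ∫⁻ y, (1 - expWeight c (max y 0)) ∂ν with hκ
    set J := ∫⁻ y in Set.Ici a, expWeight c y ∂ν with hJ
    have hκ0 : κ ≠ 0 := by
      have hme : Measurable fun y => 1 - expWeight c (max y 0) :=
        measurable_const.sub ((measurable_expWeight c).comp (by fun_prop))
      rw [hκ, Ne, lintegral_eq_zero_iff hme]
      intro h
      apply hpos
      refine measure_mono_null ?_ (ae_iff.1 h)
      intro y hy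
      simp only [Set.mem_Ioi] at hy
      simp only [Pi.zero_apply, Set.mem_ofPred_eq, tsub_eq_zero_iff_le, not_le]
      unfold expWeight
      rw [max_eq_left hy.le, ENNReal.ofReal_lt_one]
      exact Real.exp_lt_one_iff.2 (by nlinarith)
    have hJ0 : J ≠ 0 := by
      rw [hJ, Ne, lintegral_eq_zero_iff (measurable_expWeight c), Filter.EventuallyEq, ae_iff]
      have : {y | ¬ expWeight c y = (0 : ℝ → ℝ≥0∞) y} = Set.univ := by
        ext y; simp [expWeight, Real.exp_pos]
      rw [this]
      simpa using hn
    have h0 : ∀ N, partialGreen ν c N 0 ≤ κ⁻¹ := fun N => by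
      have := sum_killedStep_zero_le (ν := ν) hc.le N
      rw [ENNReal.le_inv_iff_mul_le, mul_comm]
      exact this
    refine ⟨a, ha0, expWeight c (-a) * (κ⁻¹ * J⁻¹), ?_, ?_⟩
    · unfold expWeight
      finiteness
    intro N x hx hxa
    have h1 : killedStep ν (partialGreen ν c N) 0 ≤ κ⁻¹ := by
      refine le_trans ?_ (h0 (N + 1))
      rw [partialGreen_succ]; exact le_add_self
    -- Only first steps y ≥ a from 0 are kept. The weight e^{-cy} inside `J` absorbs the factor
    -- e^{c(y-x)} lost in `killedStep_le_exp_mul`.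
    have h2 : expWeight c a * (partialGreen ν c N x * J) ≤ κ⁻¹ := by
      refine le_trans ?_ h1
      rw [hJ, ← mul_assoc, ← lintegral_const_mul _ (measurable_expWeight c)]
      simp only [killedStep_apply]
      rw [← lintegral_indicator measurableSet_Ici]
      refine lintegral_mono fun y => ?_
      by_cases hy : a ≤ y
      · have hy0 : 0 ≤ y := ha0.le.trans hy
        rw [Set.indicator_of_mem (by exact hy), zero_add, Set.indicator_of_mem (by exact hy0)]
        have h3 : partialGreen ν c N x ≤ expWeight c (x - y) * partialGreen ν c N y := by
          unfold partialGreen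
          rw [Finset.mul_sum]
          exact Finset.sum_le_sum fun n _ => killedStep_le_exp_mul (by linarith) n
        calc _ ≤ expWeight c a * (expWeight c (x - y) * partialGreen ν c N y) * expWeight c y := by
              gcongr
          _ = expWeight c (a + x) * partialGreen ν c N y := by
              rw [show a + x = a + (x - y) + y by ring, expWeight_add c _ y, expWeight_add]
              ring
          _ ≤ 1 * partialGreen ν c N y := by
              gcongr
              exact expWeight_le_one (by positivity)
          _ = _ := one_mul _
      · rw [Set.indicator_of_notMem (by exact hy)]; exact zero_le
    have hJt : J ≠ ⊤ := by
      refine ne_top_of_le_ne_top ENNReal.one_ne_top ?_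
      calc J ≤ ∫⁻ y in Set.Ici a, 1 ∂ν := by
            refine setLIntegral_mono measurable_const fun y hy => ?_
            exact expWeight_le_one (mul_nonneg hc.le (ha0.le.trans hy))
        _ ≤ 1 := by simpa using prob_le_one
    calc partialGreen ν c N x
        = expWeight c (-a) * (expWeight c a * (partialGreen ν c N x * J)) * J⁻¹ := by
          rw [← mul_assoc, ← expWeight_add, mul_assoc, mul_assoc, ENNReal.mul_inv_cancel hJ0 hJt]
          simp [expWeight]
      _ ≤ expWeight c (-a) * κ⁻¹ * J⁻¹ := by gcongr
      _ = _ := mul_assoc _ _ _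

/-- The exponentially weighted Green function of a nontrivial random walk killed below zero is
bounded, whatever the drift of the walk. -/
theorem exists_tsum_killedStep_le (hc : 0 < c) (hν : ν {0} ≠ 1) :
    ∃ C : ℝ≥0∞, C ≠ ⊤ ∧ ∀ x, 0 ≤ x → ∑' n, (killedStep ν)^[n] (expWeight c) x ≤ C := by
  obtain ⟨a, ha, K, hKt, hK⟩ := exists_partialGreen_le hc hν
  refine ⟨K * ENNReal.ofReal (1 - Real.exp (-(c * a)))⁻¹, by finiteness, fun x hx => ?_⟩
  rw [ENNReal.tsum_eq_iSup_nat]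
  exact iSup_le fun N => partialGreen_le_of_le ha hc hK N hx

end Green

/-! ### An elementary inequality for powers of the modulus -/

/-- The middle term is linear in b, so it disappears on integration when b is centred and
independent of a. For |b| ≤ |a|, write |a + b|² = |a|²(1 + s) and use the concavity of the power
γ/2; the quadratic remainder is absorbed because |a|^{γ-2}|b|² ≤ |b|^γ. For |a| ≤ |b|, each term is
compared with |b|^γ, and 4 + γ ≤ 6. -/
theorem norm_add_rpow_le {γ : ℝ} (h1 : 1 < γ) (h2 : γ ≤ 2) (a b : ℂ) :
    ‖a + b‖ ^ γ ≤ ‖a‖ ^ γ + γ * ‖a‖ ^ (γ - 2) * (starRingEnd ℂ a * b).re + 6 * ‖b‖ ^ γ := by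
  have hre : |(starRingEnd ℂ a * b).re| ≤ ‖a‖ * ‖b‖ := by
    refine (Complex.abs_re_le_norm _).trans_eq ?_
    rw [norm_mul, RCLike.norm_conj]
  have hγ0 : 0 < γ := by linarith
  rcases eq_or_ne a 0 with rfl | ha
  · simp only [zero_add, norm_zero, map_zero, zero_mul, Complex.zero_re, mul_zero, add_zero]
    rw [Real.zero_rpow hγ0.ne']
    have := Real.rpow_nonneg (norm_nonneg b) γ
    linarith
  have hA : 0 < ‖a‖ := norm_pos_iff.2 ha
  have hB := norm_nonneg b
  have hA2 : ‖a‖ ^ γ = ‖a‖ ^ (γ - 2) * ‖a‖ ^ 2 := by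
    rw [← Real.rpow_natCast, ← Real.rpow_add hA]; norm_num
  have hApos : 0 < ‖a‖ ^ (γ - 2) := Real.rpow_pos_of_pos hA _
  rcases le_total ‖b‖ ‖a‖ with hab | hab
  · set s : ℝ := (2 * (starRingEnd ℂ a * b).re + ‖b‖ ^ 2) / ‖a‖ ^ 2 with hs
    have hsq : ‖a + b‖ ^ 2 = ‖a‖ ^ 2 * (1 + s) := by
      have : ‖a + b‖ ^ 2 = ‖a‖ ^ 2 + 2 * (starRingEnd ℂ a * b).re + ‖b‖ ^ 2 := by
        rw [← Complex.normSq_eq_norm_sq, Complex.normSq_add, Complex.normSq_eq_norm_sq,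
          Complex.normSq_eq_norm_sq]
        simp only [Complex.mul_re, Complex.conj_re, Complex.conj_im]
        ring
      rw [this, hs]; field_simp; ring
    have hs1 : 0 ≤ 1 + s := by
      have : 0 ≤ ‖a‖ ^ 2 * (1 + s) := hsq ▸ sq_nonneg _
      exact nonneg_of_mul_nonneg_right this (by positivity)
    have h3 : ‖a + b‖ ^ γ = ‖a‖ ^ γ * (1 + s) ^ (γ / 2) := by
      have e : ∀ x : ℝ, 0 ≤ x → x ^ γ = (x ^ 2) ^ (γ / 2) := fun x hx => by
        rw [← Real.rpow_natCast, ← Real.rpow_mul hx]; congr 1; push_cast; ring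
      rw [e _ (norm_nonneg _), hsq, Real.mul_rpow (sq_nonneg _) hs1, ← e _ hA.le]
    have h4 : (1 + s) ^ (γ / 2) ≤ 1 + γ / 2 * s :=
      rpow_one_add_le_one_add_mul_self (by linarith) (by linarith) (by linarith)
    have h5 : ‖a‖ ^ (γ - 2) * ‖b‖ ^ 2 ≤ ‖b‖ ^ γ := by
      rcases eq_or_lt_of_le hB with hb | hb
      · rw [← hb, Real.zero_rpow hγ0.ne']; simp
      · have : ‖b‖ ^ γ = ‖b‖ ^ (γ - 2) * ‖b‖ ^ 2 := by
          rw [← Real.rpow_natCast, ← Real.rpow_add hb]; norm_num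
        rw [this]
        gcongr ?_ * _
        exact Real.rpow_le_rpow_of_nonpos hb hab (by linarith)
    have h6 : ‖a‖ ^ γ * (γ / 2 * s) = γ * ‖a‖ ^ (γ - 2) * (starRingEnd ℂ a * b).re +
        γ / 2 * (‖a‖ ^ (γ - 2) * ‖b‖ ^ 2) := by
      rw [hA2, hs]; field_simp
    have h7 : ‖a‖ ^ γ * (1 + s) ^ (γ / 2) ≤ ‖a‖ ^ γ * (1 + γ / 2 * s) := by gcongr
    have h8 := Real.rpow_nonneg hB γ
    rw [h3]
    nlinarith
  · have hb : 0 < ‖b‖ := hA.trans_le hab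
    have h3 : ‖a + b‖ ^ γ ≤ 4 * ‖b‖ ^ γ := by
      calc ‖a + b‖ ^ γ ≤ (2 * ‖b‖) ^ γ := by
            gcongr
            exact (norm_add_le a b).trans (by linarith)
        _ = 2 ^ γ * ‖b‖ ^ γ := Real.mul_rpow (by norm_num) hB
        _ ≤ (2 : ℝ) ^ (2 : ℝ) * ‖b‖ ^ γ := by
            gcongr
            norm_num
        _ = _ := by norm_num
    have h4 : -(‖b‖ ^ γ) ≤ ‖a‖ ^ (γ - 2) * (starRingEnd ℂ a * b).re := by
      have h5 : ‖a‖ ^ (γ - 2) * (‖a‖ * ‖b‖) ≤ ‖b‖ ^ γ := by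
        have e1 : ‖a‖ ^ (γ - 2) * ‖a‖ = ‖a‖ ^ (γ - 1) := by
          rw [← Real.rpow_add_one hA.ne']; congr 1; ring
        have e2 : ‖b‖ ^ γ = ‖b‖ ^ (γ - 1) * ‖b‖ := by
          rw [← Real.rpow_add_one hb.ne']; congr 1; ring
        rw [← mul_assoc, e1, e2]
        gcongr
      nlinarith [neg_abs_le (starRingEnd ℂ a * b).re]
    have h5 := Real.rpow_nonneg hA.le γ
    have h6 := Real.rpow_nonneg hB γ
    nlinarith


/-! ### Finite sequences and sums over words -/

/-- The `j`-th entry of a finite sequence of reals, or `0` if there is none. -/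
def entry (j : ℕ) (c : Σ n : ℕ, Fin n → ℝ) : ℝ :=
  if h : j < c.1 then c.2 ⟨j, h⟩ else 0

theorem measurable_sigma_iff {β : Type*} [MeasurableSpace β] {f : (Σ n : ℕ, Fin n → ℝ) → β} :
    Measurable f ↔ ∀ n, Measurable fun x : Fin n → ℝ => f ⟨n, x⟩ := by
  constructor
  · intro h n s hs
    exact MeasurableSpace.measurableSet_iInf.1 (h hs) n
  · intro h s hs
    exact MeasurableSpace.measurableSet_iInf.2 fun n => h n hs

theorem measurable_sigma_fst : Measurable fun c : Σ n : ℕ, Fin n → ℝ => c.1 :=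
  measurable_sigma_iff.2 fun _ => measurable_const

theorem measurable_entry (j : ℕ) : Measurable (entry j) := by
  refine measurable_sigma_iff.2 fun n => ?_
  unfold entry
  by_cases h : j < n
  · simp only [h, dite_true]
    exact measurable_pi_apply (⟨j, h⟩ : Fin n)
  · simp only [h, dite_false]; exact measurable_const

theorem lintegral_pointMeasure {h : ℝ → ℝ≥0∞} (hh : Measurable h) (c : Σ n : ℕ, Fin n → ℝ) :
    ∫⁻ x, h x ∂pointMeasure c = ∑' j, if j < c.1 then h (entry j c) else 0 := by
  unfold pointMeasure
  rw [lintegral_finsetSum_measure, tsum_eq_sum (s := Finset.range c.1), Finset.sum_range]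
  · refine Finset.sum_congr rfl fun j _ => ?_
    rw [lintegral_dirac' _ hh]
    simp [entry]
  · intro j hj
    simp only [Finset.mem_range] at hj
    simp [hj]

/-- The sum of a function over all words of length `n`. -/
def levelSum (n : ℕ) (F : List ℕ → ℝ≥0∞) : ℝ≥0∞ :=
  ∑' u : List ℕ, if u.length = n then F u else 0

theorem levelSum_zero (F : List ℕ → ℝ≥0∞) : levelSum 0 F = F [] := by
  unfold levelSum
  rw [tsum_eq_single []]
  · simp
  · intro u hu; simp [hu]

theorem levelSum_succ (n : ℕ) (F : List ℕ → ℝ≥0∞) :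
    levelSum (n + 1) F = levelSum n fun u => ∑' j, F (j :: u) := by
  unfold levelSum
  have hinj : Function.Injective fun p : List ℕ × ℕ => p.2 :: p.1 := by
    rintro ⟨u, j⟩ ⟨v, k⟩ h
    simp only [List.cons.injEq] at h
    exact Prod.ext h.2 h.1
  rw [← hinj.tsum_eq,
    ENNReal.tsum_prod (f := fun u j => if (j :: u).length = n + 1 then F (j :: u) else 0)]
  · refine tsum_congr fun u => ?_
    by_cases h : u.length = n <;> simp [h]
  · intro u hu
    cases u with
    | nil => simp at hu
    | cons j u => exact ⟨(u, j), rfl⟩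

theorem levelSum_add (n : ℕ) (F G : List ℕ → ℝ≥0∞) :
    levelSum n (fun u => F u + G u) = levelSum n F + levelSum n G := by
  unfold levelSum
  rw [← ENNReal.tsum_add]
  refine tsum_congr fun u => ?_
  split_ifs <;> simp

theorem levelSum_mul_right (n : ℕ) (F : List ℕ → ℝ≥0∞) (a : ℝ≥0∞) :
    levelSum n (fun u => F u * a) = levelSum n F * a := by
  unfold levelSum
  rw [← ENNReal.tsum_mul_right]
  refine tsum_congr fun u => ?_
  split_ifs <;> simp

theorem levelSum_congr {n : ℕ} {F G : List ℕ → ℝ≥0∞} (h : ∀ u, u.length = n → F u = G u) :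
    levelSum n F = levelSum n G := by
  unfold levelSum
  refine tsum_congr fun u => ?_
  split_ifs with hu
  · exact h u hu
  · rfl

theorem tsum_levelSum (F : List ℕ → ℝ≥0∞) : ∑' n, levelSum n F = ∑' u, F u := by
  unfold levelSum
  rw [ENNReal.tsum_comm]
  refine tsum_congr fun u => ?_
  rw [tsum_eq_single u.length]
  · simp
  · intro n hn; simp [hn.symm]

namespace BranchingRandomWalk

variable {Ω : Type*} [MeasurableSpace Ω] {P : Measure Ω} (B : BranchingRandomWalk P)

/-! ### Individuals that are alive and the information they carry -/

/-- The event that the word `u` is an individual of the population. -/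
def alive : List ℕ → Set Ω
  | [] => Set.univ
  | j :: u => alive u ∩ {ω | j < B.numChildren u ω}

theorem mem_generation {n : ℕ} {ω : Ω} {u : List ℕ} :
    u ∈ B.generation n ω ↔ u.length = n ∧ ω ∈ B.alive u := by
  induction n generalizing u with
  | zero =>
    simp only [generation, Finset.mem_singleton, List.length_eq_zero_iff]
    constructor
    · rintro rfl; exact ⟨rfl, Set.mem_univ _⟩
    · exact fun h => h.1
  | succ n ih =>
    simp only [generation, Finset.mem_biUnion, Finset.mem_image, Finset.mem_range, ih]
    constructor
    · rintro ⟨v, ⟨hv, ha⟩, j, hj, rfl⟩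
      exact ⟨by simp [hv], ha, hj⟩
    · rintro ⟨hl, ha⟩
      cases u with
      | nil => simp at hl
      | cons j v => exact ⟨v, ⟨by simpa using hl, ha.1⟩, j, ha.2, rfl⟩

/-- The σ-algebra generated by the reproduction of the individuals in `s`. -/
@[reducible] def sigmaOf (s : Set (List ℕ)) : MeasurableSpace Ω :=
  ⨆ v ∈ s, MeasurableSpace.comap (B.offspring v) inferInstance

theorem sigmaOf_le (s : Set (List ℕ)) : B.sigmaOf s ≤ ‹MeasurableSpace Ω› :=
  iSup₂_le fun v _ => (B.measurable_offspring v).comap_le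

theorem sigmaOf_mono {s t : Set (List ℕ)} (h : s ⊆ t) : B.sigmaOf s ≤ B.sigmaOf t :=
  biSup_mono h

theorem measurable_offspring_sigmaOf {s : Set (List ℕ)} {u : List ℕ} (h : u ∈ s) :
    Measurable[B.sigmaOf s] (B.offspring u) :=
  measurable_iff_comap_le.2 (le_iSup₂_of_le u h le_rfl)

theorem indep_sigmaOf {s : Set (List ℕ)} {u : List ℕ} (h : u ∉ s) :
    Indep (B.sigmaOf s) (MeasurableSpace.comap (B.offspring u) inferInstance) P := by
  have := indep_iSup_of_disjoint (fun v => (B.measurable_offspring v).comap_le)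
    B.iIndepFun_offspring.iIndep (Set.disjoint_singleton_right.2 h)
  simpa [sigmaOf] using this

theorem indepFun_sigmaOf {s : Set (List ℕ)} {u : List ℕ} (h : u ∉ s) {β β' : Type*}
    [MeasurableSpace β] [MeasurableSpace β'] {X : Ω → β} (hX : Measurable[B.sigmaOf s] X)
    {Y : Ω → β'} (hY : Measurable[MeasurableSpace.comap (B.offspring u) inferInstance] Y) :
    IndepFun X Y P :=
  indep_of_indep_of_le_left (indep_of_indep_of_le_right (B.indep_sigmaOf h) hY.comap_le)
    hX.comap_le

/-- The words of length less than `n`. -/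
def shorter (n : ℕ) : Set (List ℕ) := {u | u.length < n}

theorem measurable_numChildren_sigmaOf {s : Set (List ℕ)} {u : List ℕ} (h : u ∈ s) :
    Measurable[B.sigmaOf s] (B.numChildren u) :=
  measurable_sigma_fst.comp (B.measurable_offspring_sigmaOf h)

theorem measurable_displacement_sigmaOf {s : Set (List ℕ)} {u : List ℕ} (h : u ∈ s) (j : ℕ) :
    Measurable[B.sigmaOf s] (B.displacement u j) :=
  (measurable_entry j).comp (B.measurable_offspring_sigmaOf h)

theorem measurableSet_alive {n : ℕ} {u : List ℕ} (h : u.length ≤ n) :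
    MeasurableSet[B.sigmaOf (shorter n)] (B.alive u) := by
  induction u with
  | nil => exact MeasurableSet.univ
  | cons j u ih =>
    simp only [List.length_cons] at h
    exact MeasurableSet.inter (ih (by omega))
      (B.measurable_numChildren_sigmaOf (show u ∈ shorter n by simp only [shorter, Set.mem_ofPred_eq]; omega)
        (show MeasurableSet {k | j < k} from MeasurableSet.of_discrete))

theorem measurable_position {n : ℕ} {u : List ℕ} (h : u.length ≤ n) :
    Measurable[B.sigmaOf (shorter n)] (B.position u) := by
  induction u with
  | nil => exact measurable_const
  | cons j u ih =>
    simp only [List.length_cons] at h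
    exact (ih (by omega)).add
      (B.measurable_displacement_sigmaOf (by simp only [shorter, Set.mem_ofPred_eq]; omega) j)

/-! ### Integration over the children of an individual -/

theorem measurable_pointMeasure : Measurable pointMeasure := by
  refine Measure.measurable_of_measurable_coe _ fun s hs => ?_
  have : (fun c => pointMeasure c s) =
      fun c => ∑' j, if j < c.1 then s.indicator 1 (entry j c) else (0 : ℝ≥0∞) := by
    ext c
    rw [← lintegral_pointMeasure (measurable_one.indicator hs), lintegral_indicator_one hs]
  rw [this]
  refine Measurable.tsum fun j => Measurable.ite ?_ ?_ measurable_const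
  · exact measurable_sigma_fst (show MeasurableSet {k | j < k} from MeasurableSet.of_discrete)
  · exact (measurable_one.indicator hs).comp (measurable_entry j)

/-- Different individuals share the law of the point measure, not of its enumeration, so the sum is
first written as an integral against `pointMeasure`. -/
theorem lintegral_tsum_children (u : List ℕ) {h : ℝ → ℝ≥0∞} (hh : Measurable h) :
    ∫⁻ ω, ∑' j, (if j < (B.offspring u ω).1 then h (entry j (B.offspring u ω)) else 0) ∂P =
      ∫⁻ x, h x ∂B.intensity := by
  simp_rw [← lintegral_pointMeasure hh]
  unfold intensity
  have hm : Measurable fun ω => pointMeasure (B.offspring [] ω) :=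
    measurable_pointMeasure.comp (B.measurable_offspring [])
  rw [Measure.lintegral_bind hm.aemeasurable hh.aemeasurable]
  exact ((B.identDistrib_pointMeasure u).comp (Measure.measurable_lintegral hh)).lintegral_eq

/-- The branching property for one individual: `(a, v)` is independent of the reproduction of u, so
Fubini's theorem integrates out the children with `(a, v)` frozen. -/
theorem lintegral_mul_tsum_children [IsProbabilityMeasure P] {s : Set (List ℕ)} {u : List ℕ}
    (hu : u ∉ s) {a : Ω → ℝ≥0∞} (ha : Measurable[B.sigmaOf s] a) {v : Ω → ℝ}
    (hv : Measurable[B.sigmaOf s] v) {H : ℝ × ℝ → ℝ≥0∞} (hH : Measurable H) :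
    ∫⁻ ω, a ω * ∑' j, (if j < B.numChildren u ω then H (v ω, B.displacement u j ω) else 0) ∂P =
      ∫⁻ ω, a ω * ∫⁻ x, H (v ω, x) ∂B.intensity ∂P := by
  set F : (ℝ≥0∞ × ℝ) × (Σ n : ℕ, Fin n → ℝ) → ℝ≥0∞ := fun p =>
    p.1.1 * ∑' j, (if j < p.2.1 then H (p.1.2, entry j p.2) else 0) with hF
  have hFm : Measurable F := by
    refine (measurable_fst.comp measurable_fst).mul
      (Measurable.tsum fun j => Measurable.ite ?_ ?_ measurable_const)
    · exact (measurable_sigma_fst.comp measurable_snd)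
        (show MeasurableSet {k | j < k} from MeasurableSet.of_discrete)
    · exact hH.comp ((measurable_snd.comp measurable_fst).prodMk
        ((measurable_entry j).comp measurable_snd))
  have hle := B.sigmaOf_le s
  have hav : Measurable fun ω => (a ω, v ω) := (ha.mono hle le_rfl).prodMk (hv.mono hle le_rfl)
  have hind : IndepFun (fun ω => (a ω, v ω)) (B.offspring u) P :=
    B.indepFun_sigmaOf hu (ha.prodMk hv) (comap_measurable _)
  have hmap := (indepFun_iff_map_prod_eq_prod_map_map hav.aemeasurable
    (B.measurable_offspring u).aemeasurable).1 hind
  calc _ = ∫⁻ ω, F ((a ω, v ω), B.offspring u ω) ∂P := rfl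
    _ = ∫⁻ p, F p ∂(P.map fun ω => ((a ω, v ω), B.offspring u ω)) :=
        (lintegral_map hFm (hav.prodMk (B.measurable_offspring u))).symm
    _ = ∫⁻ p, ∫⁻ c, F (p, c) ∂(P.map (B.offspring u)) ∂(P.map fun ω => (a ω, v ω)) := by
        have : IsProbabilityMeasure (P.map (B.offspring u)) :=
          Measure.isProbabilityMeasure_map (B.measurable_offspring u).aemeasurable
        rw [hmap, lintegral_prod _ hFm.aemeasurable]
    _ = ∫⁻ ω, ∫⁻ c, F ((a ω, v ω), c) ∂(P.map (B.offspring u)) ∂P := by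
        have : IsProbabilityMeasure (P.map (B.offspring u)) :=
          Measure.isProbabilityMeasure_map (B.measurable_offspring u).aemeasurable
        rw [lintegral_map hFm.lintegral_prod_right' hav]
    _ = _ := by
        refine lintegral_congr fun ω => ?_
        have hFm' : Measurable fun c => F ((a ω, v ω), c) := hFm.comp measurable_prodMk_left
        rw [lintegral_map hFm' (B.measurable_offspring u)]
        simp only [hF]
        rw [lintegral_const_mul, B.lintegral_tsum_children u (h := fun x => H (v ω, x))
          (hH.comp measurable_prodMk_left)]
        refine Measurable.tsum fun j => Measurable.ite ?_ ?_ measurable_const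
        · exact (measurable_sigma_fst.comp (B.measurable_offspring u))
            (show MeasurableSet {k | j < k} from MeasurableSet.of_discrete)
        · exact hH.comp (measurable_const.prodMk
            ((measurable_entry j).comp (B.measurable_offspring u)))

/-! ### Many-to-one formula with killing -/

/-- The height `V(u) = θ S(u) + |u| ℓ` of the individual `u`. -/
def height (θ ℓ : ℝ) (u : List ℕ) (ω : Ω) : ℝ := θ * B.position u ω + u.length * ℓ

theorem height_nil (θ ℓ : ℝ) (ω : Ω) : B.height θ ℓ [] ω = 0 := by
  simp [height, position]

theorem height_cons (θ ℓ : ℝ) (j : ℕ) (u : List ℕ) (ω : Ω) :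
    B.height θ ℓ (j :: u) ω = B.height θ ℓ u ω + (θ * B.displacement u j ω + ℓ) := by
  simp only [height, position, List.length_cons]; push_cast; ring

/-- The event that `u` is alive and no individual on the ancestral line of `u` has height
below `-T`. -/
def surviving (θ ℓ T : ℝ) : List ℕ → Set Ω
  | [] => Set.univ
  | j :: u => surviving θ ℓ T u ∩ {ω | j < B.numChildren u ω} ∩
      {ω | 0 ≤ T + B.height θ ℓ (j :: u) ω}

theorem measurable_height (θ ℓ : ℝ) {n : ℕ} {u : List ℕ} (h : u.length ≤ n) :
    Measurable[B.sigmaOf (shorter n)] (B.height θ ℓ u) :=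
  ((B.measurable_position h).const_mul θ).add measurable_const

theorem measurableSet_surviving (θ ℓ T : ℝ) {n : ℕ} {u : List ℕ} (h : u.length ≤ n) :
    MeasurableSet[B.sigmaOf (shorter n)] (B.surviving θ ℓ T u) := by
  induction u with
  | nil => exact MeasurableSet.univ
  | cons j u ih =>
    have hm := B.measurable_height θ ℓ h
    simp only [List.length_cons] at h
    exact ((ih (by omega)).inter
      (B.measurable_numChildren_sigmaOf (show u ∈ shorter n by simp only [shorter, Set.mem_ofPred_eq]; omega)
        (show MeasurableSet {k | j < k} from MeasurableSet.of_discrete))).inter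
      (measurableSet_le measurable_const (measurable_const.add hm))

theorem measurable_indicator_surviving (θ ℓ T : ℝ) {n : ℕ} {u : List ℕ} (h : u.length ≤ n) :
    Measurable[B.sigmaOf (shorter n)] ((B.surviving θ ℓ T u).indicator (1 : Ω → ℝ≥0∞)) :=
  Measurable.indicator (@measurable_const _ _ _ (B.sigmaOf (shorter n)) (1 : ℝ≥0∞))
    (B.measurableSet_surviving θ ℓ T h)

/-- The law of the increments of the height, tilted by `e^{-αV}`. -/
def tiltedLaw (θ ℓ α : ℝ) : Measure ℝ :=
  (B.intensity.withDensity fun x => expWeight α (θ * x + ℓ)).map fun x => θ * x + ℓ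

theorem lintegral_tiltedLaw (θ ℓ α : ℝ) {g : ℝ → ℝ≥0∞} (hg : Measurable g) :
    ∫⁻ y, g y ∂B.tiltedLaw θ ℓ α =
      ∫⁻ x, expWeight α (θ * x + ℓ) * g (θ * x + ℓ) ∂B.intensity := by
  unfold tiltedLaw
  rw [lintegral_map hg (by fun_prop), lintegral_withDensity_eq_lintegral_mul]
  · rfl
  · exact (measurable_expWeight α).comp (by fun_prop)
  · exact hg.comp (by fun_prop)

/-- The sum over the surviving individuals of generation `n`, weighted by `e^{-αV}`. -/
def survivingSum (θ ℓ T α : ℝ) (n : ℕ) (g : ℝ → ℝ≥0∞) : ℝ≥0∞ :=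
  levelSum n fun u => ∫⁻ ω, (B.surviving θ ℓ T u).indicator 1 ω *
    expWeight α (B.height θ ℓ u ω) * g (T + B.height θ ℓ u ω) ∂P

theorem survivingSum_zero [IsProbabilityMeasure P] (θ ℓ T α : ℝ) (g : ℝ → ℝ≥0∞) :
    B.survivingSum θ ℓ T α 0 g = g T := by
  unfold survivingSum
  rw [levelSum_zero]
  simp [surviving, height_nil, expWeight]

theorem lintegral_surviving_children [IsProbabilityMeasure P] (θ ℓ T α : ℝ) (u : List ℕ)
    {g : ℝ → ℝ≥0∞} (hg : Measurable g) :
    ∫⁻ ω, ∑' j, ((B.surviving θ ℓ T u).indicator 1 ω * if j < B.numChildren u ω then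
        expWeight α (B.height θ ℓ (j :: u) ω) * g (T + B.height θ ℓ (j :: u) ω) else 0) ∂P =
      ∫⁻ ω, (B.surviving θ ℓ T u).indicator 1 ω * expWeight α (B.height θ ℓ u ω) *
        ∫⁻ y, g (T + B.height θ ℓ u ω + y) ∂B.tiltedLaw θ ℓ α ∂P := by
  set H : ℝ × ℝ → ℝ≥0∞ := fun p => expWeight α (θ * p.2 + ℓ) * g (T + p.1 + (θ * p.2 + ℓ)) with hH
  have hHm : Measurable H :=
    ((measurable_expWeight α).comp (by fun_prop)).mul (hg.comp (by fun_prop))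
  have key := B.lintegral_mul_tsum_children (s := shorter u.length) (u := u)
    (by simp [shorter])
    (a := fun ω => (B.surviving θ ℓ T u).indicator 1 ω * expWeight α (B.height θ ℓ u ω))
    (Measurable.mul (B.measurable_indicator_surviving θ ℓ T le_rfl)
      ((measurable_expWeight α).comp (B.measurable_height θ ℓ le_rfl)))
    (B.measurable_height θ ℓ (u := u) le_rfl) hHm
  convert key using 1
  · refine lintegral_congr fun ω => ?_
    rw [← ENNReal.tsum_mul_left]
    refine tsum_congr fun j => ?_
    simp only [hH]
    rw [height_cons, expWeight_add, add_assoc T]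
    split_ifs <;> ring
  · refine lintegral_congr fun ω => ?_
    congr 1
    have hg' : Measurable fun y => g (T + B.height θ ℓ u ω + y) := hg.comp (by fun_prop)
    rw [B.lintegral_tiltedLaw _ _ _ hg']

/-- Integrating out the last generation costs one step of the killed walk: the factor
e^{-α(increment)} turns the intensity into the tilted law, and the survival constraint on the
children is the indicator in `killedStep`. -/
theorem survivingSum_succ [IsProbabilityMeasure P] (θ ℓ T α : ℝ) (n : ℕ) {g : ℝ → ℝ≥0∞}
    (hg : Measurable g) : B.survivingSum θ ℓ T α (n + 1) g =
      B.survivingSum θ ℓ T α n (killedStep (B.tiltedLaw θ ℓ α) g) := by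
  classical
  unfold survivingSum
  rw [levelSum_succ]
  refine levelSum_congr fun u hu => ?_
  rw [← lintegral_tsum]
  swap
  · refine fun j => (Measurable.mono (Measurable.mul (Measurable.mul ?_ ?_) (hg.comp ?_))
      (B.sigmaOf_le (shorter (j :: u).length)) le_rfl).aemeasurable
    · exact B.measurable_indicator_surviving θ ℓ T le_rfl
    · exact (measurable_expWeight α).comp (B.measurable_height θ ℓ le_rfl)
    · exact measurable_const.add (B.measurable_height θ ℓ le_rfl)
  simp only [killedStep_apply]
  rw [← B.lintegral_surviving_children θ ℓ T α u (hg.indicator measurableSet_Ici)]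
  refine lintegral_congr fun ω => tsum_congr fun j => ?_
  simp only [Set.indicator_apply]
  have hmem : ω ∈ B.surviving θ ℓ T (j :: u) ↔ (ω ∈ B.surviving θ ℓ T u ∧
      j < B.numChildren u ω) ∧ 0 ≤ T + B.height θ ℓ (j :: u) ω := Iff.rfl
  rw [hmem]
  by_cases h1 : ω ∈ B.surviving θ ℓ T u <;> by_cases h2 : j < B.numChildren u ω <;>
    by_cases h3 : 0 ≤ T + B.height θ ℓ (j :: u) ω <;> simp [h1, h2, h3]

theorem survivingSum_eq [IsProbabilityMeasure P] (θ ℓ T α : ℝ)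
    [IsProbabilityMeasure (B.tiltedLaw θ ℓ α)] (n : ℕ) {g : ℝ → ℝ≥0∞} (hg : Measurable g) :
    B.survivingSum θ ℓ T α n g = (killedStep (B.tiltedLaw θ ℓ α))^[n] g T := by
  induction n generalizing g with
  | zero => exact B.survivingSum_zero θ ℓ T α g
  | succ n ih =>
    rw [B.survivingSum_succ _ _ _ _ _ hg, ih (measurable_killedStep _ hg),
      Function.iterate_succ_apply]


/-! ### The probability that some individual falls below `-T` -/

/-- The event that `u` is the first individual on its ancestral line with height below `-T`. -/
def exits (θ ℓ T : ℝ) : List ℕ → Set Ω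
  | [] => ∅
  | j :: u => B.surviving θ ℓ T u ∩ {ω | j < B.numChildren u ω} ∩
      {ω | T + B.height θ ℓ (j :: u) ω < 0}

theorem exists_mem_exits {θ ℓ T : ℝ} {u : List ℕ} {ω : Ω} (hu : ω ∈ B.alive u)
    (hs : ω ∉ B.surviving θ ℓ T u) : ∃ v, ω ∈ B.exits θ ℓ T v := by
  induction u with
  | nil => exact absurd (Set.mem_univ ω) hs
  | cons j u ih =>
    by_cases h : ω ∈ B.surviving θ ℓ T u
    · refine ⟨j :: u, ⟨h, hu.2⟩, ?_⟩
      by_contra hlt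
      have hge : 0 ≤ T + B.height θ ℓ (j :: u) ω := not_lt.1 hlt
      exact hs ⟨⟨h, hu.2⟩, hge⟩
    · exact ih hu.1 h

theorem measurableSet_exits (θ ℓ T : ℝ) (u : List ℕ) : MeasurableSet (B.exits θ ℓ T u) := by
  cases u with
  | nil => exact MeasurableSet.empty
  | cons j u =>
    refine MeasurableSet.inter (MeasurableSet.inter ?_ ?_) ?_
    · exact B.sigmaOf_le _ _ (B.measurableSet_surviving θ ℓ T le_rfl)
    · exact measurable_sigma_fst.comp (B.measurable_offspring u)
        (show MeasurableSet {k | j < k} from MeasurableSet.of_discrete)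
    · exact measurableSet_lt (measurable_const.add
        ((B.measurable_height θ ℓ le_rfl).mono (B.sigmaOf_le _) le_rfl)) measurable_const

/-- At an exit T + V < 0, hence 1 ≤ e^{-αT}e^{-αV}. -/
theorem measure_exits_children_le [IsProbabilityMeasure P] {θ ℓ T α : ℝ} (hα : 0 ≤ α)
    (u : List ℕ) :
    ∑' j, P (B.exits θ ℓ T (j :: u)) ≤ expWeight α T *
      ∫⁻ ω, (B.surviving θ ℓ T u).indicator 1 ω * expWeight α (B.height θ ℓ u ω) *
        ∫⁻ y, (Set.Iio 0).indicator 1 (T + B.height θ ℓ u ω + y) ∂B.tiltedLaw θ ℓ α ∂P := by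
  classical
  have h1 : Measurable ((Set.Iio (0 : ℝ)).indicator (1 : ℝ → ℝ≥0∞)) :=
    measurable_one.indicator measurableSet_Iio
  rw [← B.lintegral_surviving_children θ ℓ T α u h1, ← lintegral_const_mul']
  swap
  · exact ENNReal.ofReal_ne_top
  have h2 : ∀ j, P (B.exits θ ℓ T (j :: u)) =
      ∫⁻ ω, (B.exits θ ℓ T (j :: u)).indicator 1 ω ∂P := fun j =>
    (lintegral_indicator_one (B.measurableSet_exits θ ℓ T _)).symm
  simp_rw [h2]
  rw [← lintegral_tsum fun j =>
    (measurable_one.indicator (B.measurableSet_exits θ ℓ T _)).aemeasurable]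
  refine lintegral_mono fun ω => ?_
  rw [← ENNReal.tsum_mul_left]
  refine ENNReal.tsum_le_tsum fun j => ?_
  by_cases h : ω ∈ B.exits θ ℓ T (j :: u)
  · obtain ⟨⟨h3, h4⟩, h5⟩ := h
    simp only [Set.mem_ofPred_eq] at h4 h5
    rw [Set.indicator_of_mem (show ω ∈ B.exits θ ℓ T (j :: u) from ⟨⟨h3, h4⟩, h5⟩),
      Set.indicator_of_mem h3, if_pos h4, Set.indicator_of_mem (by exact h5)]
    simp only [Pi.one_apply, one_mul, mul_one]
    rw [← expWeight_add]
    unfold expWeight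
    rw [ENNReal.one_le_ofReal]
    apply Real.one_le_exp
    nlinarith
  · rw [Set.indicator_of_notMem h]; exact zero_le

/-- The probability that the height of some individual falls below `-T`. -/
theorem measure_exists_not_surviving_le [IsProbabilityMeasure P] {θ ℓ T α : ℝ} (hα : 0 ≤ α)
    [IsProbabilityMeasure (B.tiltedLaw θ ℓ α)] :
    P {ω | ∃ u, ω ∈ B.alive u ∧ ω ∉ B.surviving θ ℓ T u} ≤ expWeight α T := by
  set R : ℝ → ℝ≥0∞ := fun x => ∫⁻ y, (Set.Iio 0).indicator 1 (x + y) ∂B.tiltedLaw θ ℓ α with hR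
  have hRk : ∀ x, R x + killedStep (B.tiltedLaw θ ℓ α) 1 x = 1 := by
    intro x
    have hm : Measurable fun y : ℝ => (Set.Iio (0 : ℝ)).indicator (1 : ℝ → ℝ≥0∞) (x + y) :=
      (measurable_one.indicator measurableSet_Iio).comp (by fun_prop)
    rw [killedStep_apply, hR, ← lintegral_add_left hm]
    calc _ = ∫⁻ _, 1 ∂B.tiltedLaw θ ℓ α := by
          refine lintegral_congr fun y => ?_
          by_cases h : x + y < 0
          · rw [Set.indicator_of_mem (by exact h), Set.indicator_of_notMem (by simpa using h)]
            simp
          · rw [Set.indicator_of_notMem (by exact h), Set.indicator_of_mem (by simpa using h)]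
            simp
      _ = 1 := by simp
  -- Conservation of mass: the e^{-αV}-mass surviving at generation n either exits or survives at
  -- generation n + 1. Hence the total exit mass is at most the initial mass 1.
  have hstep : ∀ n, B.survivingSum θ ℓ T α n R + B.survivingSum θ ℓ T α (n + 1) 1 =
      B.survivingSum θ ℓ T α n 1 := by
    intro n
    rw [B.survivingSum_succ _ _ _ _ _ measurable_one]
    unfold survivingSum
    rw [← levelSum_add]
    refine levelSum_congr fun u _ => ?_
    rw [← lintegral_add_right]
    · refine lintegral_congr fun ω => ?_
      rw [← mul_add, hRk, Pi.one_apply]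
    · refine Measurable.mono (Measurable.mul (Measurable.mul ?_ ?_)
        ((measurable_killedStep _ measurable_one).comp ?_))
        (B.sigmaOf_le (shorter u.length)) le_rfl
      · exact B.measurable_indicator_surviving θ ℓ T le_rfl
      · exact (measurable_expWeight α).comp (B.measurable_height θ ℓ le_rfl)
      · exact measurable_const.add (B.measurable_height θ ℓ le_rfl)
  have hsum : ∀ N, ∑ n ∈ Finset.range N, B.survivingSum θ ℓ T α n R +
      B.survivingSum θ ℓ T α N 1 = 1 := by
    intro N
    induction N with
    | zero => simp [B.survivingSum_zero]
    | succ N ih => rw [Finset.sum_range_succ, add_assoc, hstep, ih]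
  calc P {ω | ∃ u, ω ∈ B.alive u ∧ ω ∉ B.surviving θ ℓ T u}
      ≤ P (⋃ u, B.exits θ ℓ T u) := measure_mono fun ω ⟨u, h1, h2⟩ =>
        Set.mem_iUnion.2 (B.exists_mem_exits h1 h2)
    _ ≤ ∑' u, P (B.exits θ ℓ T u) := measure_iUnion_le _
    _ = ∑' n, levelSum n fun u => P (B.exits θ ℓ T u) := (tsum_levelSum _).symm
    _ = ∑' n, levelSum n fun u => ∑' j, P (B.exits θ ℓ T (j :: u)) := by
        -- The ancestor never exits, so level 0 drops out and the remaining levels are indexed by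
        -- parents.
        rw [tsum_eq_zero_add' ENNReal.summable, levelSum_zero]
        simp [exits, levelSum_succ]
    _ ≤ ∑' n, expWeight α T * B.survivingSum θ ℓ T α n R := by
        refine ENNReal.tsum_le_tsum fun n => ?_
        unfold survivingSum levelSum
        rw [← ENNReal.tsum_mul_left]
        refine ENNReal.tsum_le_tsum fun u => ?_
        split_ifs
        · exact B.measure_exits_children_le hα u
        · exact zero_le
    _ = expWeight α T * ∑' n, B.survivingSum θ ℓ T α n R := ENNReal.tsum_mul_left
    _ ≤ expWeight α T * 1 := by
        gcongr
        rw [ENNReal.tsum_eq_iSup_nat]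
        exact iSup_le fun N => le_self_add.trans_eq (hsum N)
    _ = expWeight α T := mul_one _

/-! ### A von Bahr–Esseen inequality along the tree -/

/-- Summands are added one at a time with `norm_add_rpow_le`. The linear term has mean zero, since
`Y u` is centred and independent of its coefficient, and the last term factorizes. -/
theorem integral_norm_sum_rpow_le [IsProbabilityMeasure P] {γ : ℝ} (h1 : 1 < γ) (h2 : γ ≤ 2)
    {Y ζ : List ℕ → Ω → ℂ} {K M : ℝ}
    (hYm : ∀ u, Measurable[MeasurableSpace.comap (B.offspring u) inferInstance] (Y u))
    (hYp : ∀ u, MemLp (Y u) (ENNReal.ofReal γ) P) (hY0 : ∀ u, ∫ ω, Y u ω ∂P = 0)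
    (hYK : ∀ u, ∫ ω, ‖Y u ω‖ ^ γ ∂P = K)
    (hζm : ∀ u, Measurable[B.sigmaOf (shorter u.length)] (ζ u)) (hζM : ∀ u ω, ‖ζ u ω‖ ≤ M)
    (s : Finset (List ℕ)) :
    MemLp (fun ω => ∑ u ∈ s, ζ u ω * Y u ω) (ENNReal.ofReal γ) P ∧
    ∫ ω, ‖∑ u ∈ s, ζ u ω * Y u ω‖ ^ γ ∂P ≤ ∑ u ∈ s, 6 * K * ∫ ω, ‖ζ u ω‖ ^ γ ∂P := by
  have hγ0 : 0 < γ := by linarith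
  have hp0 : ENNReal.ofReal γ ≠ 0 := by simpa using hγ0
  have hpr : (ENNReal.ofReal γ).toReal = γ := ENNReal.toReal_ofReal hγ0.le
  have hζm' : ∀ u, Measurable (ζ u) := fun u => (hζm u).mono (B.sigmaOf_le _) le_rfl
  have hYm' : ∀ u, Measurable (Y u) := fun u =>
    (hYm u).mono (B.measurable_offspring u).comap_le le_rfl
  have hterm : ∀ u, MemLp (fun ω => ζ u ω * Y u ω) (ENNReal.ofReal γ) P := fun u =>
    (hYp u).of_le_mul (c := M) ((hζm' u).mul (hYm' u)).aestronglyMeasurable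
      (Eventually.of_forall fun ω => by
        rw [norm_mul]; exact mul_le_mul_of_nonneg_right (hζM u ω) (norm_nonneg _))
  have hint : ∀ {f : Ω → ℂ}, MemLp f (ENNReal.ofReal γ) P →
      Integrable (fun ω => ‖f ω‖ ^ γ) P := fun hf => by
    simpa [hpr] using hf.integrable_norm_rpow hp0 ENNReal.ofReal_ne_top
  have hmem : ∀ s : Finset (List ℕ),
      MemLp (fun ω => ∑ u ∈ s, ζ u ω * Y u ω) (ENNReal.ofReal γ) P := fun s =>
    memLp_finsetSum s fun u _ => hterm u
  refine ⟨hmem s, ?_⟩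
  -- A word u of maximal length is added last: then `ζ v` for v in s, like `ζ u`, depends only on
  -- words shorter than u, and `Y v` only on v ≠ u, so all of them are independent of `Y u`.
  induction s using Finset.induction_on_max_value (fun u : List ℕ => u.length) with
  | empty => simp [Real.zero_rpow hγ0.ne']
  | insert u s hu hmax ih =>
    have hA : Measurable[B.sigmaOf {u}ᶜ] fun ω => ∑ v ∈ s, ζ v ω * Y v ω := by
      refine Finset.measurable_fun_sum (m := B.sigmaOf {u}ᶜ) s fun v hv => ?_
      have hvu : v ≠ u := fun h => hu (h ▸ hv)
      refine Measurable.mul ?_ ?_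
      · refine (hζm v).mono (B.sigmaOf_mono fun w hw hwu => ?_) le_rfl
        simp only [Set.mem_singleton_iff] at hwu
        have := hmax v hv
        simp only [shorter, Set.mem_ofPred_eq, hwu] at hw
        omega
      · exact (hYm v).mono (le_iSup₂_of_le (f := fun v (_ : v ∈ ({u}ᶜ : Set (List ℕ))) =>
          MeasurableSpace.comap (B.offspring v) inferInstance) v hvu le_rfl) le_rfl
    have hζu : Measurable[B.sigmaOf {u}ᶜ] (ζ u) := by
      refine (hζm u).mono (B.sigmaOf_mono fun w hw hwu => ?_) le_rfl
      simp only [Set.mem_singleton_iff] at hwu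
      simp [shorter, hwu] at hw
    set A : Ω → ℂ := fun ω => ∑ v ∈ s, ζ v ω * Y v ω with hAdef
    -- The coefficient of `Y u` in the linear term of `norm_add_rpow_le`.
    set X : Ω → ℂ := fun ω => ((γ * ‖A ω‖ ^ (γ - 2) : ℝ) : ℂ) * (starRingEnd ℂ (A ω) * ζ u ω)
      with hX
    have hXm : Measurable[B.sigmaOf {u}ᶜ] X := by
      refine Measurable.mul ?_ (Measurable.mul ?_ hζu)
      · exact (Complex.measurable_ofReal.comp
          (measurable_const.mul (measurable_id.pow_const (γ - 2)))).comp (measurable_norm.comp hA)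
      · exact Complex.continuous_conj.measurable.comp hA
    have hunot : u ∉ ({u}ᶜ : Set (List ℕ)) := by simp
    have hM0 : 0 ≤ M := (norm_nonneg _).trans (hζM u (Classical.choice P.nonempty_of_neZero))
    have hXi : Integrable X P := by
      have hdom : Integrable (fun ω => γ * M * (1 + ‖A ω‖ ^ γ)) P :=
        ((integrable_const 1).add (hint (hmem s))).const_mul _
      refine hdom.mono' (hXm.mono (B.sigmaOf_le _) le_rfl).aestronglyMeasurable
        (Eventually.of_forall fun ω => ?_)
      have h3 : ‖X ω‖ = γ * (‖A ω‖ ^ (γ - 2) * ‖A ω‖) * ‖ζ u ω‖ := by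
        simp only [hX]
        rw [norm_mul, norm_mul, RCLike.norm_conj, Complex.norm_real, Real.norm_of_nonneg
          (by positivity)]
        ring
      have h4 : ‖A ω‖ ^ (γ - 2) * ‖A ω‖ ≤ 1 + ‖A ω‖ ^ γ := by
        rcases eq_or_lt_of_le (norm_nonneg (A ω)) with h | h
        · rw [← h]; simp [Real.zero_rpow hγ0.ne']
        · rw [← Real.rpow_add_one h.ne']
          rcases le_total ‖A ω‖ 1 with h5 | h5
          · have := Real.rpow_le_one h.le h5 (by linarith : 0 ≤ γ - 2 + 1)
            have := Real.rpow_nonneg h.le γ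
            linarith
          · have := Real.rpow_le_rpow_of_exponent_le h5 (by linarith : γ - 2 + 1 ≤ γ)
            linarith
      rw [h3]
      calc _ ≤ γ * (1 + ‖A ω‖ ^ γ) * M := by
            gcongr
            exact hζM u ω
        _ = _ := by ring
    have hYi : Integrable (Y u) P := (hYp u).integrable (by
      rw [← ENNReal.ofReal_one]; exact ENNReal.ofReal_le_ofReal h1.le)
    have hXY : IndepFun X (Y u) P := B.indepFun_sigmaOf hunot hXm (hYm u)
    have hcross : ∫ ω, (X ω * Y u ω).re ∂P = 0 := by
      have h3 : Integrable (fun ω => X ω * Y u ω) P := hXY.integrable_mul hXi hYi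
      have h4 := hXY.integral_mul_eq_mul_integral hXi.aestronglyMeasurable hYi.aestronglyMeasurable
      rw [hY0, mul_zero] at h4
      have h5 := integral_re h3
      simp only [Pi.mul_apply] at h4
      rw [h4] at h5
      simpa using h5
    have hcrossi : Integrable (fun ω => (X ω * Y u ω).re) P :=
      (hXY.integrable_mul hXi hYi).re
    have hprod : ∫ ω, ‖ζ u ω * Y u ω‖ ^ γ ∂P = (∫ ω, ‖ζ u ω‖ ^ γ ∂P) * K := by
      have hpow : Measurable fun x : ℂ => ‖x‖ ^ γ := by fun_prop
      have h3 : IndepFun (fun ω => ‖ζ u ω‖ ^ γ) (fun ω => ‖Y u ω‖ ^ γ) P :=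
        B.indepFun_sigmaOf hunot (hpow.comp hζu) (hpow.comp (hYm u))
      have h4 := h3.integral_mul_eq_mul_integral
        (hpow.comp (hζm' u)).aestronglyMeasurable (hpow.comp (hYm' u)).aestronglyMeasurable
      rw [hYK] at h4
      rw [← h4]
      refine integral_congr_ae (Eventually.of_forall fun ω => ?_)
      simp only [Pi.mul_apply]
      rw [norm_mul, Real.mul_rpow (norm_nonneg _) (norm_nonneg _)]
    rw [Finset.sum_insert hu]
    calc ∫ ω, ‖∑ v ∈ insert u s, ζ v ω * Y v ω‖ ^ γ ∂P
        ≤ ∫ ω, (‖A ω‖ ^ γ + (X ω * Y u ω).re + 6 * ‖ζ u ω * Y u ω‖ ^ γ) ∂P := by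
          refine integral_mono (hint (hmem _)) ?_ fun ω => ?_
          · exact ((hint (hmem s)).add hcrossi).add ((hint (hterm u)).const_mul 6)
          · simp only []
            rw [Finset.sum_insert hu, add_comm (ζ u ω * Y u ω)]
            refine (norm_add_rpow_le h1 h2 (A ω) (ζ u ω * Y u ω)).trans_eq ?_
            simp only [hX]
            rw [mul_assoc (Complex.ofReal _), Complex.re_ofReal_mul, mul_assoc (starRingEnd ℂ _)]
      _ = ∫ ω, ‖A ω‖ ^ γ ∂P + 6 * ((∫ ω, ‖ζ u ω‖ ^ γ ∂P) * K) := by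
          have hi : Integrable (fun ω => ‖A ω‖ ^ γ + (X ω * Y u ω).re) P :=
            (hint (hmem s)).add hcrossi
          rw [integral_add hi ((hint (hterm u)).const_mul 6),
            integral_add (hint (hmem s)) hcrossi, hcross, integral_const_mul, hprod, add_zero]
      _ ≤ _ := by linarith

end BranchingRandomWalk


/-! ### Linear functionals of the reproduction point process -/

theorem measurable_sum_entry {f : ℝ → ℂ} (hf : Measurable f) :
    Measurable fun c : Σ n : ℕ, Fin n → ℝ => ∑ j ∈ Finset.range c.1, f (entry j c) := by
  refine measurable_sigma_iff.2 fun n => ?_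
  exact Finset.measurable_fun_sum (Finset.range n) fun j _ =>
    hf.comp (measurable_sigma_iff.1 (measurable_entry j) n)

theorem lintegral_pointMeasure_eq_sum {h : ℝ → ℝ≥0∞} (hh : Measurable h)
    (c : Σ n : ℕ, Fin n → ℝ) :
    ∫⁻ x, h x ∂pointMeasure c = ∑ j ∈ Finset.range c.1, h (entry j c) := by
  rw [lintegral_pointMeasure hh, tsum_eq_sum (s := Finset.range c.1)]
  · exact Finset.sum_congr rfl fun j hj => if_pos (Finset.mem_range.1 hj)
  · exact fun j hj => if_neg fun h => hj (Finset.mem_range.2 h)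

/-- The integral of a real function, as a measurable function of the measure. -/
def realIntegral (f : ℝ → ℝ) (κ : Measure ℝ) : ℝ :=
  (∫⁻ x, ENNReal.ofReal (f x) ∂κ).toReal - (∫⁻ x, ENNReal.ofReal (-f x) ∂κ).toReal

theorem measurable_realIntegral {f : ℝ → ℝ} (hf : Measurable f) : Measurable (realIntegral f) :=
  (Measure.measurable_lintegral hf.ennreal_ofReal).ennreal_toReal.sub
    (Measure.measurable_lintegral hf.neg.ennreal_ofReal).ennreal_toReal

theorem realIntegral_pointMeasure {f : ℝ → ℝ} (hf : Measurable f) (c : Σ n : ℕ, Fin n → ℝ) :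
    realIntegral f (pointMeasure c) = ∑ j ∈ Finset.range c.1, f (entry j c) := by
  have hf' : Measurable fun x => ENNReal.ofReal (-f x) := hf.neg.ennreal_ofReal
  unfold realIntegral
  rw [lintegral_pointMeasure_eq_sum hf.ennreal_ofReal, lintegral_pointMeasure_eq_sum hf',
    ENNReal.toReal_sum fun _ _ => ENNReal.ofReal_ne_top,
    ENNReal.toReal_sum fun _ _ => ENNReal.ofReal_ne_top, ← Finset.sum_sub_distrib]
  refine Finset.sum_congr rfl fun j _ => ?_
  rw [ENNReal.toReal_ofReal', ENNReal.toReal_ofReal']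
  exact max_zero_sub_eq_self _

/-- The sum of `e^{-zx}` over a finite sequence of reals. -/
def childSum (z : ℂ) (c : Σ n : ℕ, Fin n → ℝ) : ℂ :=
  ∑ j ∈ Finset.range c.1, Complex.exp (-z * entry j c)

theorem measurable_childSum (z : ℂ) : Measurable (childSum z) :=
  measurable_sum_entry (f := fun x : ℝ => Complex.exp (-z * x)) (by fun_prop)

namespace BranchingRandomWalk

variable {Ω : Type*} [MeasurableSpace Ω] {P : Measure Ω} (B : BranchingRandomWalk P)

theorem integral_sum_children_of_nonneg {f : ℝ → ℝ} (hf : Measurable f) (hf0 : 0 ≤ f)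
    (hfi : Integrable f B.intensity) :
    Integrable (fun ω => ∑ j ∈ Finset.range (B.offspring [] ω).1, f (entry j (B.offspring [] ω))) P ∧
    ∫ ω, ∑ j ∈ Finset.range (B.offspring [] ω).1, f (entry j (B.offspring [] ω)) ∂P =
      ∫ x, f x ∂B.intensity := by
  have hm : Measurable fun ω =>
      ∑ j ∈ Finset.range (B.offspring [] ω).1, f (entry j (B.offspring [] ω)) := by
    simp_rw [← realIntegral_pointMeasure hf]
    exact (measurable_realIntegral hf).comp
      (measurable_pointMeasure.comp (B.measurable_offspring []))
  have hl : ∫⁻ ω, ENNReal.ofReal (∑ j ∈ Finset.range (B.offspring [] ω).1,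
      f (entry j (B.offspring [] ω))) ∂P = ∫⁻ x, ENNReal.ofReal (f x) ∂B.intensity := by
    rw [← B.lintegral_tsum_children [] hf.ennreal_ofReal]
    refine lintegral_congr fun ω => ?_
    rw [← lintegral_pointMeasure hf.ennreal_ofReal,
      lintegral_pointMeasure_eq_sum hf.ennreal_ofReal,
      ENNReal.ofReal_sum_of_nonneg fun _ _ => hf0 _]
  have h0 : 0 ≤ fun ω => ∑ j ∈ Finset.range (B.offspring [] ω).1,
      f (entry j (B.offspring [] ω)) := fun ω => Finset.sum_nonneg fun _ _ => hf0 _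
  constructor
  · refine ⟨hm.aestronglyMeasurable, ?_⟩
    rw [hasFiniteIntegral_iff_ofReal (Eventually.of_forall h0), hl]
    exact (hasFiniteIntegral_iff_ofReal (Eventually.of_forall hf0)).1 hfi.2
  · rw [integral_eq_lintegral_of_nonneg_ae (Eventually.of_forall h0) hm.aestronglyMeasurable,
      integral_eq_lintegral_of_nonneg_ae (Eventually.of_forall hf0) hf.aestronglyMeasurable, hl]

theorem integral_sum_children {f : ℝ → ℝ} (hf : Measurable f) (hfi : Integrable f B.intensity) :
    Integrable (fun ω => ∑ j ∈ Finset.range (B.offspring [] ω).1, f (entry j (B.offspring [] ω))) P ∧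
    ∫ ω, ∑ j ∈ Finset.range (B.offspring [] ω).1, f (entry j (B.offspring [] ω)) ∂P =
      ∫ x, f x ∂B.intensity := by
  obtain ⟨hp1, hp2⟩ := B.integral_sum_children_of_nonneg (f := fun x => max (f x) 0)
    (hf.max measurable_const) (fun x => le_max_right _ _) hfi.pos_part
  obtain ⟨hn1, hn2⟩ := B.integral_sum_children_of_nonneg (f := fun x => max (-f x) 0)
    (hf.neg.max measurable_const) (fun x => le_max_right _ _) hfi.neg_part
  have he : (fun ω => ∑ j ∈ Finset.range (B.offspring [] ω).1, f (entry j (B.offspring [] ω))) =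
      fun ω => (∑ j ∈ Finset.range (B.offspring [] ω).1, max (f (entry j (B.offspring [] ω))) 0) -
        ∑ j ∈ Finset.range (B.offspring [] ω).1, max (-f (entry j (B.offspring [] ω))) 0 := by
    funext ω
    rw [← Finset.sum_sub_distrib]
    exact Finset.sum_congr rfl fun j _ => (max_zero_sub_eq_self _).symm
  rw [he]
  refine ⟨hp1.sub hn1, ?_⟩
  rw [integral_sub hp1 hn1, hp2, hn2, ← integral_sub hfi.pos_part hfi.neg_part]
  exact integral_congr_ae (Eventually.of_forall fun x => max_zero_sub_eq_self _)

/-- `childSum` is read off an enumeration but depends only on the point measure, through a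
measurable functional built from `realIntegral`; equality of the laws of the point measures
therefore suffices. -/
theorem identDistrib_childSum (z : ℂ) (u : List ℕ) :
    IdentDistrib (fun ω => childSum z (B.offspring u ω))
      (fun ω => childSum z (B.offspring [] ω)) P P := by
  have hre : Measurable fun x : ℝ => (Complex.exp (-z * x)).re := by fun_prop
  have him : Measurable fun x : ℝ => (Complex.exp (-z * x)).im := by fun_prop
  set Φ : Measure ℝ → ℂ := fun κ =>
    (realIntegral (fun x : ℝ => (Complex.exp (-z * x)).re) κ : ℂ) +
      (realIntegral (fun x : ℝ => (Complex.exp (-z * x)).im) κ : ℂ) * Complex.I with hΦ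
  have hΦm : Measurable Φ :=
    (Complex.measurable_ofReal.comp (measurable_realIntegral hre)).add
      ((Complex.measurable_ofReal.comp (measurable_realIntegral him)).mul measurable_const)
  have he : ∀ c, childSum z c = Φ (pointMeasure c) := by
    intro c
    simp only [hΦ]
    rw [realIntegral_pointMeasure hre, realIntegral_pointMeasure him]
    unfold childSum
    apply Complex.ext <;> simp
  simp_rw [he]
  exact (B.identDistrib_pointMeasure u).comp hΦm

theorem integrable_childSum {z : ℂ} (hz : z ∈ B.domain) (u : List ℕ) :
    Integrable (fun ω => childSum z (B.offspring u ω)) P ∧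
      ∫ ω, childSum z (B.offspring u ω) ∂P = B.m z := by
  have hre : Measurable fun x : ℝ => (Complex.exp (-z * x)).re := by fun_prop
  have him : Measurable fun x : ℝ => (Complex.exp (-z * x)).im := by fun_prop
  have hzi : Integrable (fun x : ℝ => Complex.exp (-z * x)) B.intensity := hz
  obtain ⟨hr1, hr2⟩ := B.integral_sum_children hre hzi.re
  obtain ⟨hi1, hi2⟩ := B.integral_sum_children him hzi.im
  have h0 : Integrable (fun ω => childSum z (B.offspring [] ω)) P := by
    have : (fun ω => childSum z (B.offspring [] ω)) = fun ω =>
        ((∑ j ∈ Finset.range (B.offspring [] ω).1,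
          (Complex.exp (-z * entry j (B.offspring [] ω))).re : ℝ) : ℂ) +
        ((∑ j ∈ Finset.range (B.offspring [] ω).1,
          (Complex.exp (-z * entry j (B.offspring [] ω))).im : ℝ) : ℂ) * Complex.I := by
      funext ω
      unfold childSum
      apply Complex.ext <;> simp
    rw [this]
    exact hr1.ofReal.add (hi1.ofReal.mul_const _)
  refine ⟨(B.identDistrib_childSum z u).integrable_iff.2 h0, ?_⟩
  rw [(B.identDistrib_childSum z u).integral_eq]
  unfold m
  rw [← integral_re_add_im h0, ← integral_re_add_im hzi]
  congr 2
  · refine Eq.trans (integral_congr_ae (Eventually.of_forall fun ω => ?_)) hr2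
    simp [childSum]
  · congr 1
    refine Eq.trans (integral_congr_ae (Eventually.of_forall fun ω => ?_)) hi2
    simp [childSum]

/-! ### Decomposition of the additive martingale into weighted fluctuations -/

/-- The normalized fluctuation `Z_1 - 1` of the reproduction of `u`. -/
def fluctuation (z : ℂ) (u : List ℕ) (ω : Ω) : ℂ :=
  (B.m z)⁻¹ * childSum z (B.offspring u ω) - 1

theorem identDistrib_fluctuation (z : ℂ) (u : List ℕ) :
    IdentDistrib (B.fluctuation z u) (B.fluctuation z []) P P :=
  (B.identDistrib_childSum z u).comp (u := fun w => (B.m z)⁻¹ * w - 1) (by fun_prop)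

theorem measurable_fluctuation (z : ℂ) (u : List ℕ) :
    Measurable[MeasurableSpace.comap (B.offspring u) inferInstance] (B.fluctuation z u) := by
  have h : Measurable fun c => (B.m z)⁻¹ * childSum z c - 1 :=
    ((measurable_childSum z).const_mul _).sub_const _
  exact h.comp (comap_measurable _)

theorem integrable_fluctuation [IsProbabilityMeasure P] {z : ℂ} (hz : z ∈ B.domain)
    (u : List ℕ) : Integrable (B.fluctuation z u) P :=
  ((B.integrable_childSum hz u).1.const_mul _).sub (integrable_const _)

theorem integral_fluctuation [IsProbabilityMeasure P] {z : ℂ} (hz : z ∈ B.domain)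
    (hm : B.m z ≠ 0) (u : List ℕ) : ∫ ω, B.fluctuation z u ω ∂P = 0 := by
  unfold fluctuation
  rw [integral_sub ((B.integrable_childSum hz u).1.const_mul _) (integrable_const _),
    integral_const_mul, (B.integrable_childSum hz u).2, inv_mul_cancel₀ hm]
  simp

/-- The summand `e^{-zS(u)} / m(z)^{|u|}` of the additive martingale. -/
def weight (z : ℂ) (u : List ℕ) (ω : Ω) : ℂ :=
  Complex.exp (-z * B.position u ω) * (B.m z ^ u.length)⁻¹

theorem measurable_weight (z : ℂ) {n : ℕ} {u : List ℕ} (h : u.length ≤ n) :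
    Measurable[B.sigmaOf (shorter n)] (B.weight z u) := by
  have h1 : Measurable fun x : ℝ => Complex.exp (-z * x) * (B.m z ^ u.length)⁻¹ := by fun_prop
  exact h1.comp (B.measurable_position h)

theorem norm_weight {z : ℂ} (hm : B.m z ≠ 0) (u : List ℕ) (ω : Ω) :
    ‖B.weight z u ω‖ = Real.exp (-B.height z.re (Real.log ‖B.m z‖) u ω) := by
  have hpos : 0 < ‖B.m z‖ := norm_pos_iff.2 hm
  unfold weight height
  rw [norm_mul, Complex.norm_exp, norm_inv, norm_pow, neg_add, Real.exp_add,
    Real.exp_neg (u.length * _), Real.exp_nat_mul, Real.exp_log hpos]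
  simp

theorem additiveMartingale_eq (z : ℂ) (n : ℕ) (ω : Ω) :
    B.additiveMartingale z n ω = ∑ u ∈ B.generation n ω, B.weight z u ω := by
  unfold additiveMartingale weight
  rw [Finset.mul_sum]
  refine Finset.sum_congr rfl fun u hu => ?_
  rw [(B.mem_generation.1 hu).1, mul_comm]

theorem additiveMartingale_zero (z : ℂ) (ω : Ω) : B.additiveMartingale z 0 ω = 1 := by
  simp [additiveMartingale, generation, position]

theorem additiveMartingale_succ (z : ℂ) (n : ℕ) (ω : Ω) :
    B.additiveMartingale z (n + 1) ω = B.additiveMartingale z n ω +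
      ∑ u ∈ B.generation n ω, B.weight z u ω * B.fluctuation z u ω := by
  rw [additiveMartingale_eq, additiveMartingale_eq, ← Finset.sum_add_distrib]
  simp only [generation]
  rw [Finset.sum_biUnion]
  · refine Finset.sum_congr rfl fun u _ => ?_
    rw [Finset.sum_image fun i _ j _ h => (List.cons.inj h).1]
    unfold fluctuation childSum
    rw [mul_sub, mul_one, add_sub_cancel, ← mul_assoc, Finset.mul_sum]
    refine Finset.sum_congr rfl fun j _ => ?_
    have : entry j (B.offspring u ω) = B.displacement u j ω := rfl
    rw [this]
    unfold weight
    simp only [position, List.length_cons]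
    push_cast
    rw [mul_add, Complex.exp_add, pow_succ, mul_inv]
    ring
  · intro u _ v _ huv
    refine Finset.disjoint_left.2 fun w hw hw' => huv ?_
    obtain ⟨i, _, rfl⟩ := Finset.mem_image.1 hw
    obtain ⟨j, _, h⟩ := Finset.mem_image.1 hw'
    exact (List.cons.inj h).2.symm

theorem additiveMartingale_sub_one (z : ℂ) (n : ℕ) (ω : Ω) :
    B.additiveMartingale z n ω - 1 =
      ∑ u ∈ (Finset.range n).biUnion fun k => B.generation k ω,
        B.weight z u ω * B.fluctuation z u ω := by
  rw [Finset.sum_biUnion]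
  · induction n with
    | zero => simp [additiveMartingale_zero]
    | succ n ih =>
      rw [Finset.sum_range_succ, ← ih, additiveMartingale_succ]; ring
  · intro i _ j _ hij
    refine Finset.disjoint_left.2 fun u hu hu' => hij ?_
    rw [← (B.mem_generation.1 hu).1, (B.mem_generation.1 hu').1]

theorem additiveMartingale_one (z : ℂ) (ω : Ω) :
    B.additiveMartingale z 1 ω = B.fluctuation z [] ω + 1 := by
  rw [additiveMartingale_succ, additiveMartingale_zero]
  simp [generation, weight, position, add_comm]

/-! ### The tail of the additive martingale -/

/-- Either some individual falls below −T, or the truncated sum is at least e^T in modulus. The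
first event costs e^{-αT}, and Chebyshev's inequality with exponent γ gives the same order for the
second. -/
theorem exists_tail_bound [IsProbabilityMeasure P] {z : ℂ} (hz : z ∈ B.domain)
    (hm : B.m z ≠ 0) {α γ : ℝ} (hα : 1 < α) (hγ : γ ∈ Set.Ioc α 2)
    [IsProbabilityMeasure (B.tiltedLaw z.re (Real.log ‖B.m z‖) α)]
    (hν : B.tiltedLaw z.re (Real.log ‖B.m z‖) α {0} ≠ 1)
    (hY : MemLp (B.fluctuation z []) (ENNReal.ofReal γ) P) :
    ∃ C : ℝ≥0∞, C ≠ ⊤ ∧ ∀ T, 0 ≤ T → ∀ n,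
      P {ω | Real.exp T ≤ ‖B.additiveMartingale z n ω - 1‖} ≤ C * expWeight α T := by
  set θ := z.re
  set ℓ := Real.log ‖B.m z‖
  have hγα : 0 < γ - α := sub_pos.2 hγ.1
  have hγ0 : 0 < γ := by linarith [hγ.1]
  obtain ⟨G, hGt, hG⟩ := exists_tsum_killedStep_le hγα hν
  set K : ℝ := ∫ ω, ‖B.fluctuation z [] ω‖ ^ γ ∂P with hK
  have hK0 : 0 ≤ K := integral_nonneg fun ω => Real.rpow_nonneg (norm_nonneg _) _
  refine ⟨1 + ENNReal.ofReal (6 * K) * G, by finiteness, fun T hT n => ?_⟩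
  set bad : Set Ω := {ω | ∃ u, ω ∈ B.alive u ∧ ω ∉ B.surviving θ ℓ T u} with hbad
  set ζ : List ℕ → Ω → ℂ := fun u => (B.surviving θ ℓ T u).indicator (B.weight z u) with hζ
  set A : Finset (List ℕ) → Ω → ℂ := fun s ω =>
    ∑ u ∈ s.filter (fun u => u.length < n), ζ u ω * B.fluctuation z u ω with hA
  have hpow : ∀ ω u, ENNReal.ofReal (‖B.weight z u ω‖ ^ γ) =
      expWeight γ (B.height θ ℓ u ω) := fun ω u => by
    rw [B.norm_weight hm, ← Real.exp_mul]
    unfold expWeight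
    congr 2
    ring
  have hsurv : ∀ u ω, ω ∈ B.surviving θ ℓ T u → 0 ≤ T + B.height θ ℓ u ω := by
    intro u ω h
    cases u with
    | nil => rw [height_nil]; simpa using hT
    | cons j u => exact h.2
  have hζm : ∀ u, Measurable[B.sigmaOf (shorter u.length)] (ζ u) := fun u =>
    Measurable.indicator (B.measurable_weight z le_rfl) (B.measurableSet_surviving θ ℓ T le_rfl)
  have hζM : ∀ u ω, ‖ζ u ω‖ ≤ Real.exp T := by
    intro u ω
    by_cases h : ω ∈ B.surviving θ ℓ T u
    · simp only [hζ, Set.indicator_of_mem h]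
      rw [B.norm_weight hm]
      exact Real.exp_le_exp.2 (by linarith [hsurv u ω h])
    · simp only [hζ, Set.indicator_of_notMem h, norm_zero]
      positivity
  have hYp : ∀ u, MemLp (B.fluctuation z u) (ENNReal.ofReal γ) P := fun u =>
    (B.identDistrib_fluctuation z u).memLp_iff.2 hY
  have hnormpow : Measurable fun x : ℂ => ‖x‖ ^ γ := by fun_prop
  have hYK : ∀ u, ∫ ω, ‖B.fluctuation z u ω‖ ^ γ ∂P = K := fun u =>
    ((B.identDistrib_fluctuation z u).comp hnormpow).integral_eq
  have hVBE := fun s => B.integral_norm_sum_rpow_le (by linarith [hγ.1]) hγ.2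
    (B.measurable_fluctuation z) hYp (B.integral_fluctuation hz hm) hYK hζm hζM s
  have hζm' : ∀ u, Measurable (ζ u) := fun u => (hζm u).mono (B.sigmaOf_le _) le_rfl
  have hYm' : ∀ u, Measurable (B.fluctuation z u) := fun u =>
    (B.measurable_fluctuation z u).mono (B.measurable_offspring u).comap_le le_rfl
  have hAm : ∀ s, Measurable (A s) := fun s =>
    Finset.measurable_fun_sum _ fun u _ => (hζm' u).mul (hYm' u)
  -- Split e^{-γV} = e^{(γ-α)T} · e^{-αV} · e^{-(γ-α)(T+V)}: the middle factor performs the tilting,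
  -- and the last one is the weight in the Green function.
  have hζsum : ∑' u, ∫⁻ ω, ENNReal.ofReal (‖ζ u ω‖ ^ γ) ∂P ≤ expWeight (γ - α) (-T) * G := by
    have he : ∀ u, ∫⁻ ω, ENNReal.ofReal (‖ζ u ω‖ ^ γ) ∂P = expWeight (γ - α) (-T) *
        ∫⁻ ω, (B.surviving θ ℓ T u).indicator 1 ω * expWeight α (B.height θ ℓ u ω) *
          expWeight (γ - α) (T + B.height θ ℓ u ω) ∂P := by
      intro u
      rw [← lintegral_const_mul' (expWeight (γ - α) (-T)) _ ENNReal.ofReal_ne_top]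
      refine lintegral_congr fun ω => ?_
      by_cases h : ω ∈ B.surviving θ ℓ T u
      · simp only [hζ, Set.indicator_of_mem h, Pi.one_apply, one_mul]
        rw [hpow ω u]
        unfold expWeight
        rw [← ENNReal.ofReal_mul (Real.exp_nonneg _), ← ENNReal.ofReal_mul (Real.exp_nonneg _),
          ← Real.exp_add, ← Real.exp_add]
        congr 2
        ring
      · simp [hζ, Set.indicator_of_notMem h, Real.zero_rpow hγ0.ne']
    simp_rw [he]
    rw [ENNReal.tsum_mul_left, ← tsum_levelSum]
    gcongr
    refine le_trans (le_of_eq (tsum_congr fun k => ?_)) (hG T hT)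
    exact B.survivingSum_eq θ ℓ T α k (measurable_expWeight _)
  have hAint : ∀ s, ∫⁻ ω, ENNReal.ofReal (‖A s ω‖ ^ γ) ∂P ≤
      ENNReal.ofReal (6 * K) * (expWeight (γ - α) (-T) * G) := by
    intro s
    have hγp0 : ENNReal.ofReal γ ≠ 0 := by simpa using hγ0
    have hi : Integrable (fun ω => ‖A s ω‖ ^ γ) P := by
      simpa [ENNReal.toReal_ofReal hγ0.le] using
        (hVBE (s.filter fun u => u.length < n)).1.integrable_norm_rpow hγp0 ENNReal.ofReal_ne_top
    have hζi : ∀ u, Integrable (fun ω => ‖ζ u ω‖ ^ γ) P := fun u => by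
      refine (integrable_const (Real.exp T ^ γ)).mono' (hnormpow.comp (hζm' u)).aestronglyMeasurable
        (Eventually.of_forall fun ω => ?_)
      rw [Real.norm_of_nonneg (Real.rpow_nonneg (norm_nonneg _) _)]
      exact Real.rpow_le_rpow (norm_nonneg _) (hζM u ω) hγ0.le
    rw [← ofReal_integral_eq_lintegral_ofReal hi
      (Eventually.of_forall fun ω => Real.rpow_nonneg (norm_nonneg _) _)]
    refine (ENNReal.ofReal_le_ofReal (hVBE _).2).trans ?_
    rw [← Finset.mul_sum, ENNReal.ofReal_mul (by positivity)]
    gcongr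
    rw [ENNReal.ofReal_sum_of_nonneg fun u _ =>
      integral_nonneg fun ω => Real.rpow_nonneg (norm_nonneg _) _]
    refine le_trans ?_ hζsum
    refine le_trans (le_of_eq (Finset.sum_congr rfl fun u _ => ?_)) (ENNReal.sum_le_tsum _)
    exact ofReal_integral_eq_lintegral_ofReal (hζi u)
      (Eventually.of_forall fun ω => Real.rpow_nonneg (norm_nonneg _) _)
  have hlim : ∀ ω, ω ∉ bad → ∀ᶠ s in atTop, A s ω = B.additiveMartingale z n ω - 1 := by
    intro ω hω
    filter_upwards [eventually_ge_atTop ((Finset.range n).biUnion fun k => B.generation k ω)]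
      with s hs
    rw [additiveMartingale_sub_one]
    symm
    refine Finset.sum_subset_zero_on_sdiff (fun u hu => ?_) (fun u hu => ?_) fun u hu => ?_
    · refine Finset.mem_filter.2 ⟨hs hu, ?_⟩
      obtain ⟨k, hk, hku⟩ := Finset.mem_biUnion.1 hu
      rw [(B.mem_generation.1 hku).1]
      exact Finset.mem_range.1 hk
    · obtain ⟨hu1, hu2⟩ := Finset.mem_sdiff.1 hu
      have hna : ω ∉ B.surviving θ ℓ T u := by
        intro hsu
        refine hu2 (Finset.mem_biUnion.2 ⟨u.length,
          Finset.mem_range.2 (Finset.mem_filter.1 hu1).2, B.mem_generation.2 ⟨rfl, ?_⟩⟩)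
        clear * - hsu
        induction u with
        | nil => exact Set.mem_univ _
        | cons j u ih => exact ⟨ih hsu.1.1, hsu.1.2⟩
      simp [hζ, Set.indicator_of_notMem hna]
    · obtain ⟨k, _, hku⟩ := Finset.mem_biUnion.1 hu
      have hsu : ω ∈ B.surviving θ ℓ T u := by
        by_contra h
        exact hω ⟨u, (B.mem_generation.1 hku).2, h⟩
      simp [hζ, Set.indicator_of_mem hsu]
  -- The set of potential individuals of length below n may be infinite, while the moment bound is
  -- for finite sets of words. Fatou's lemma along an exhausting sequence bridges the gap, as off
  -- `bad` the finite sums are eventually equal to Z_n − 1.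
  obtain ⟨σ, hσ⟩ := exists_seq_tendsto (atTop : Filter (Finset (List ℕ)))
  set F : Ω → ℝ≥0∞ := fun ω => liminf (fun k => ENNReal.ofReal (‖A (σ k) ω‖ ^ γ)) atTop with hF
  have hFm : Measurable F := Measurable.liminf fun k => (hnormpow.comp (hAm (σ k))).ennreal_ofReal
  have hFint : ∫⁻ ω, F ω ∂P ≤ ENNReal.ofReal (6 * K) * (expWeight (γ - α) (-T) * G) := by
    refine (lintegral_liminf_le fun k => (hnormpow.comp (hAm (σ k))).ennreal_ofReal).trans ?_
    exact liminf_le_of_frequently_le' (Eventually.of_forall fun k => hAint (σ k)).frequently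
  have hsub : {ω | Real.exp T ≤ ‖B.additiveMartingale z n ω - 1‖} ⊆
      bad ∪ {ω | ENNReal.ofReal (Real.exp T ^ γ) ≤ F ω} := by
    intro ω hω
    by_cases hb : ω ∈ bad
    · exact Or.inl hb
    · right
      have hFe : F ω = ENNReal.ofReal (‖B.additiveMartingale z n ω - 1‖ ^ γ) := by
        refine Tendsto.liminf_eq (tendsto_const_nhds.congr' ?_)
        filter_upwards [hσ.eventually (hlim ω hb)] with s hs
        rw [hs]
      simp only [Set.mem_ofPred_eq] at hω ⊢
      rw [hFe]
      exact ENNReal.ofReal_le_ofReal (Real.rpow_le_rpow (Real.exp_nonneg _) hω hγ0.le)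
  have hcheb : P {ω | ENNReal.ofReal (Real.exp T ^ γ) ≤ F ω} ≤
      ENNReal.ofReal (6 * K) * G * expWeight α T := by
    refine (meas_ge_le_lintegral_div hFm.aemeasurable (by positivity) ENNReal.ofReal_ne_top).trans ?_
    rw [ENNReal.div_eq_inv_mul, ← Real.exp_mul, ← ENNReal.ofReal_inv_of_pos (Real.exp_pos _),
      ← Real.exp_neg]
    calc _ ≤ ENNReal.ofReal (Real.exp (-(T * γ))) *
          (ENNReal.ofReal (6 * K) * (expWeight (γ - α) (-T) * G)) := by gcongr
      _ = ENNReal.ofReal (6 * K) * G *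
          (ENNReal.ofReal (Real.exp (-(T * γ))) * expWeight (γ - α) (-T)) := by ring
      _ = _ := by
          congr 1
          unfold expWeight
          rw [← ENNReal.ofReal_mul (Real.exp_nonneg _), ← Real.exp_add]
          congr 2
          ring
  calc _ ≤ P bad + P {ω | ENNReal.ofReal (Real.exp T ^ γ) ≤ F ω} :=
        (measure_mono hsub).trans (measure_union_le _ _)
    _ ≤ expWeight α T + ENNReal.ofReal (6 * K) * G * expWeight α T :=
        add_le_add (B.measure_exists_not_surviving_le (by linarith)) hcheb
    _ = _ := by ring

end BranchingRandomWalk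


/-! ### Tails, moments and convergence in `L^p` -/

/-- Layer-cake formula, with the tail bounded by 1 on (0, 1] and by C t^{-α} beyond. `D` is chosen
before the random variable, so it serves all n at once. -/
theorem exists_lintegral_rpow_le_of_tail {α p : ℝ} (hp : 0 < p) (hpα : p < α) {C : ℝ≥0∞}
    (hC : C ≠ ⊤) : ∃ D : ℝ≥0∞, D ≠ ⊤ ∧
      ∀ {Ω : Type*} [MeasurableSpace Ω] (P : Measure Ω) [IsProbabilityMeasure P] {X : Ω → ℂ},
        Measurable X → (∀ T, 0 ≤ T → P {ω | Real.exp T ≤ ‖X ω‖} ≤ C * expWeight α T) →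
        ∫⁻ ω, ‖X ω‖ₑ ^ p ∂P ≤ D := by
  have hfin : ∀ {s : Set ℝ} {r : ℝ}, IntegrableOn (fun t : ℝ => t ^ r) s →
      ∫⁻ t in s, ENNReal.ofReal (t ^ r) ≠ ⊤ := fun h =>
    (ne_of_lt (lt_of_le_of_lt (lintegral_ofReal_le_lintegral_enorm _) h.2))
  refine ⟨ENNReal.ofReal p * ((∫⁻ t in Set.Ioc (0 : ℝ) 1, ENNReal.ofReal (t ^ (p - 1))) +
    C * ∫⁻ t in Set.Ioi (1 : ℝ), ENNReal.ofReal (t ^ (p - 1 - α))), ?_, ?_⟩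
  · have h1 : ∫⁻ t in Set.Ioc (0 : ℝ) 1, ENNReal.ofReal (t ^ (p - 1)) ≠ ⊤ := by
      refine hfin ?_
      rw [← intervalIntegrable_iff_integrableOn_Ioc_of_le zero_le_one]
      exact intervalIntegral.intervalIntegrable_rpow' (by linarith)
    have h2 : ∫⁻ t in Set.Ioi (1 : ℝ), ENNReal.ofReal (t ^ (p - 1 - α)) ≠ ⊤ :=
      hfin (integrableOn_Ioi_rpow_of_lt (by linarith) one_pos)
    finiteness
  · intro Ω _ P _ X hX ht
    have h1 : ∫⁻ ω, ‖X ω‖ₑ ^ p ∂P = ∫⁻ ω, ENNReal.ofReal (‖X ω‖ ^ p) ∂P := by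
      refine lintegral_congr fun ω => ?_
      rw [← ENNReal.ofReal_rpow_of_nonneg (norm_nonneg _) hp.le, ofReal_norm]
    rw [h1, lintegral_rpow_eq_lintegral_meas_le_mul P
      (Eventually.of_forall fun ω => norm_nonneg _) hX.norm.aemeasurable hp]
    gcongr
    rw [← Set.Ioc_union_Ioi_eq_Ioi (zero_le_one' ℝ),
      lintegral_union measurableSet_Ioi (Set.Ioc_disjoint_Ioi le_rfl)]
    refine add_le_add (lintegral_mono fun t => ?_) ?_
    · exact (mul_le_mul_left (prob_le_one (μ := P)) _).trans_eq (one_mul _)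
    · rw [← lintegral_const_mul' _ _ hC]
      refine setLIntegral_mono' measurableSet_Ioi fun t h => ?_
      have h0 : (0 : ℝ) < t := one_pos.trans h
      have h2 := ht (Real.log t) (Real.log_nonneg (le_of_lt h))
      rw [Real.exp_log h0] at h2
      refine (mul_le_mul_left h2 _).trans_eq ?_
      unfold expWeight
      rw [mul_assoc, ← ENNReal.ofReal_mul (Real.exp_nonneg _)]
      congr 2
      rw [show p - 1 - α = -α + (p - 1) by ring, Real.rpow_add h0, Real.rpow_def_of_pos h0 (-α)]
      congr 2
      ring

theorem enorm_add_rpow_le {p : ℝ} (hp : 0 ≤ p) (a b : ℝ≥0∞) :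
    (a + b) ^ p ≤ 2 ^ p * (a ^ p + b ^ p) := by
  calc (a + b) ^ p ≤ (2 * max a b) ^ p := by
        gcongr
        rw [two_mul]
        exact add_le_add (le_max_left _ _) (le_max_right _ _)
    _ = 2 ^ p * (max a b) ^ p := ENNReal.mul_rpow_of_nonneg _ _ hp
    _ ≤ _ := by
        gcongr
        rcases le_total a b with h | h
        · rw [max_eq_right h]; exact le_add_self
        · rw [max_eq_left h]; exact le_self_add

/-- Truncate at k: the bounded part tends to 0 by dominated convergence, and the excess is at most
k^{p-q} D, uniformly in n, because x^p ≤ k^{p-q} x^q for x ≥ k. -/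
theorem tendsto_lintegral_rpow_zero {Ω : Type*} [MeasurableSpace Ω] {P : Measure Ω}
    [IsFiniteMeasure P] {f : ℕ → Ω → ℂ} (hf : ∀ n, Measurable (f n))
    (hlim : ∀ᵐ ω ∂P, Tendsto (fun n => f n ω) atTop (𝓝 0)) {p q : ℝ} (hp : 0 < p) (hpq : p < q)
    {D : ℝ≥0∞} (hD : D ≠ ⊤) (hb : ∀ n, ∫⁻ ω, ‖f n ω‖ₑ ^ q ∂P ≤ D) :
    Tendsto (fun n => ∫⁻ ω, ‖f n ω‖ₑ ^ p ∂P) atTop (𝓝 0) := by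
  have htrunc : ∀ k : ℕ, Tendsto (fun n => ∫⁻ ω, (min ‖f n ω‖ₑ k) ^ p ∂P) atTop (𝓝 0) := by
    intro k
    have h := tendsto_lintegral_of_dominated_convergence (μ := P)
      (F := fun n ω => (min ‖f n ω‖ₑ k) ^ p) (f := fun _ => 0) (fun _ => (k : ℝ≥0∞) ^ p)
      (fun n => ((hf n).enorm.min measurable_const).pow_const p)
      (fun n => Eventually.of_forall fun ω => ENNReal.rpow_le_rpow (min_le_right _ _) hp.le)
      (by
        rw [lintegral_const]
        exact ENNReal.mul_ne_top (ENNReal.rpow_ne_top_of_nonneg hp.le (ENNReal.natCast_ne_top k))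
          (measure_ne_top _ _)) ?_
    · simpa using h
    · filter_upwards [hlim] with ω hω
      have h1 : Tendsto (fun n => ‖f n ω‖ₑ) atTop (𝓝 0) := by
        simpa using hω.enorm
      have h2 := ((h1.min (tendsto_const_nhds (x := (k : ℝ≥0∞)))).ennrpow_const p)
      simpa [ENNReal.zero_rpow_of_pos hp] using h2
  have hpt : ∀ k : ℕ, k ≠ 0 → ∀ x : ℝ≥0∞,
      x ^ p ≤ (min x k) ^ p + (k : ℝ≥0∞) ^ (p - q) * x ^ q := by
    intro k hk x
    have hk0 : (k : ℝ≥0∞) ≠ 0 := by exact_mod_cast hk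
    have hkt : (k : ℝ≥0∞) ≠ ⊤ := ENNReal.natCast_ne_top k
    rcases le_total x k with h | h
    · rw [min_eq_left h]; exact le_self_add
    · refine le_trans ?_ le_add_self
      rcases eq_or_ne x ⊤ with rfl | hx
      · rw [ENNReal.top_rpow_of_pos (hp.trans hpq), ENNReal.mul_top]
        · exact le_top
        · exact (ENNReal.rpow_pos (pos_iff_ne_zero.2 hk0) hkt).ne'
      have hx0 : x ≠ 0 := (lt_of_lt_of_le (pos_iff_ne_zero.2 hk0) h).ne'
      calc x ^ p = x ^ (p - q) * x ^ q := by rw [← ENNReal.rpow_add _ _ hx0 hx]; ring_nf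
        _ ≤ _ := by
            gcongr ?_ * _
            rw [← neg_sub q p, ENNReal.rpow_neg, ENNReal.rpow_neg, ENNReal.inv_le_inv]
            exact ENNReal.rpow_le_rpow h (by linarith)
  have hsmall : Tendsto (fun k : ℕ => (k : ℝ≥0∞) ^ (p - q) * D) atTop (𝓝 0) := by
    have h1 : Tendsto (fun k : ℕ => ((k : ℝ≥0∞) ^ (q - p))⁻¹) atTop (𝓝 0) := by
      have := ENNReal.tendsto_nat_nhds_top.ennrpow_const (q - p)
      rw [ENNReal.top_rpow_of_pos (sub_pos.2 hpq)] at this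
      simpa using tendsto_inv_iff.2 this
    have h2 := ENNReal.Tendsto.mul_const h1 (Or.inr hD)
    rw [zero_mul] at h2
    refine h2.congr fun k => ?_
    rw [← ENNReal.rpow_neg, neg_sub]
  rw [ENNReal.tendsto_nhds_zero]
  intro ε hε
  have hε2 : 0 < ε / 2 := ENNReal.half_pos hε.ne'
  obtain ⟨k, hk, hk0⟩ :=
    ((ENNReal.tendsto_nhds_zero.1 hsmall (ε / 2) hε2).and (eventually_ne_atTop 0)).exists
  filter_upwards [ENNReal.tendsto_nhds_zero.1 (htrunc k) (ε / 2) hε2] with n hn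
  calc ∫⁻ ω, ‖f n ω‖ₑ ^ p ∂P
      ≤ ∫⁻ ω, ((min ‖f n ω‖ₑ k) ^ p + (k : ℝ≥0∞) ^ (p - q) * ‖f n ω‖ₑ ^ q) ∂P :=
        lintegral_mono fun ω => hpt k hk0 _
    _ = ∫⁻ ω, (min ‖f n ω‖ₑ k) ^ p ∂P + (k : ℝ≥0∞) ^ (p - q) * ∫⁻ ω, ‖f n ω‖ₑ ^ q ∂P := by
        rw [lintegral_add_left (((hf n).enorm.min measurable_const).pow_const p),
          lintegral_const_mul _ ((hf n).enorm.pow_const q)]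
    _ ≤ ε / 2 + ε / 2 := add_le_add hn ((mul_le_mul_right (hb n) _).trans hk)
    _ = ε := ENNReal.add_halves ε

/-- The sum over the random index set is the pointwise limit of the sums of `g` over fixed finite
sets, eventually constant at each ω. -/
theorem measurable_sum_random_finset {Ω ι : Type*} [Countable ι] {m : MeasurableSpace Ω}
    {G : Ω → Finset ι} {f g : ι → Ω → ℂ} (hg : ∀ i, Measurable (g i))
    (h1 : ∀ i ω, i ∈ G ω → g i ω = f i ω) (h0 : ∀ i ω, i ∉ G ω → g i ω = 0) :
    Measurable fun ω => ∑ i ∈ G ω, f i ω := by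
  classical
  refine measurable_of_tendsto_metrizable' (atTop : Filter (Finset ι))
    (f := fun s ω => ∑ i ∈ s, g i ω)
    (fun s => Finset.measurable_fun_sum s fun i _ => hg i) ?_
  refine tendsto_pi_nhds.2 fun ω => tendsto_const_nhds.congr' ?_
  filter_upwards [eventually_ge_atTop (G ω)] with s hs
  refine Finset.sum_subset_zero_on_sdiff hs (fun i hi => ?_) fun i hi => ?_
  · exact h0 i ω (Finset.mem_sdiff.1 hi).2
  · exact (h1 i ω hi).symm

namespace BranchingRandomWalk

variable {Ω : Type*} [MeasurableSpace Ω] {P : Measure Ω} (B : BranchingRandomWalk P)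

/-! ### The additive martingale is a martingale -/

/-- The filtration of the generations. -/
def generationFiltration : Filtration ℕ ‹MeasurableSpace Ω› where
  seq n := B.sigmaOf (shorter n)
  mono' _ _ h := B.sigmaOf_mono fun _ hu => lt_of_lt_of_le hu h
  le' _ := B.sigmaOf_le _

/-- The summand of the additive martingale at time `n` that belongs to the word `u`. -/
def generationWeight (z : ℂ) (n : ℕ) (u : List ℕ) : Ω → ℂ :=
  {ω | u ∈ B.generation n ω}.indicator (B.weight z u)

theorem generationWeight_of_mem {z : ℂ} {n : ℕ} {u : List ℕ} {ω : Ω}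
    (h : u ∈ B.generation n ω) : B.generationWeight z n u ω = B.weight z u ω :=
  Set.indicator_of_mem (s := {ω | u ∈ B.generation n ω}) h _

theorem generationWeight_of_notMem {z : ℂ} {n : ℕ} {u : List ℕ} {ω : Ω}
    (h : u ∉ B.generation n ω) : B.generationWeight z n u ω = 0 :=
  Set.indicator_of_notMem (s := {ω | u ∈ B.generation n ω}) h _

theorem generationWeight_of_length_ne {z : ℂ} {n : ℕ} {u : List ℕ} (h : u.length ≠ n) (ω : Ω) :
    B.generationWeight z n u ω = 0 :=
  B.generationWeight_of_notMem fun h' => h (B.mem_generation.1 h').1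

theorem measurable_generationWeight (z : ℂ) (n : ℕ) (u : List ℕ) :
    Measurable[B.sigmaOf (shorter n)] (B.generationWeight z n u) := by
  by_cases h : u.length = n
  · refine Measurable.indicator (B.measurable_weight z h.le) ?_
    have : {ω | u ∈ B.generation n ω} = B.alive u := by
      ext ω; exact B.mem_generation.trans (and_iff_right h)
    rw [this]
    exact B.measurableSet_alive h.le
  · have : B.generationWeight z n u = fun _ => 0 :=
      funext (B.generationWeight_of_length_ne h)
    rw [this]
    exact measurable_const

theorem measurable_additiveMartingale (z : ℂ) (n : ℕ) :
    Measurable[B.sigmaOf (shorter n)] (B.additiveMartingale z n) := by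
  have : B.additiveMartingale z n = fun ω => ∑ u ∈ B.generation n ω, B.weight z u ω :=
    funext fun ω => B.additiveMartingale_eq z n ω
  rw [this]
  exact measurable_sum_random_finset (m := B.sigmaOf (shorter n))
    (B.measurable_generationWeight z n) (fun _ _ h => B.generationWeight_of_mem h)
    fun _ _ h => B.generationWeight_of_notMem h

/-- By the branching property the sum is q^n, where q is the integral of |e^{-zx}|/|m(z)| against
the intensity, finite since z lies in the domain. This permits exchanging sum and expectation in the
martingale property. -/
theorem tsum_lintegral_weight_ne_top [IsProbabilityMeasure P] {z : ℂ} (hz : z ∈ B.domain)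
    (hm : B.m z ≠ 0) (n : ℕ) :
    ∑' u, ∫⁻ ω, ‖B.generationWeight z n u ω‖ₑ ∂P ≠ ⊤ := by
  classical
  set θ := z.re
  set ℓ := Real.log ‖B.m z‖
  set J : List ℕ → ℝ≥0∞ := fun u =>
    ∫⁻ ω, (B.alive u).indicator 1 ω * expWeight 1 (B.height θ ℓ u ω) ∂P with hJ
  set q : ℝ≥0∞ := ∫⁻ x, expWeight 1 (θ * x + ℓ) ∂B.intensity with hq
  have hqt : q ≠ ⊤ := by
    have hzi : Integrable (fun x : ℝ => Complex.exp (-z * x)) B.intensity := hz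
    have : q = (∫⁻ x, ‖Complex.exp (-z * x)‖ₑ ∂B.intensity) * expWeight 1 ℓ := by
      rw [hq, ← lintegral_mul_const' (expWeight 1 ℓ) _ ENNReal.ofReal_ne_top]
      refine lintegral_congr fun x => ?_
      rw [expWeight_add, ← ofReal_norm, Complex.norm_exp]
      congr 1
      unfold expWeight
      congr 2
      simp [θ]
    rw [this]
    exact ENNReal.mul_ne_top hzi.2.ne ENNReal.ofReal_ne_top
  have halive : ∀ u, Measurable[B.sigmaOf (shorter u.length)]
      ((B.alive u).indicator (1 : Ω → ℝ≥0∞)) := fun u =>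
    Measurable.indicator (@measurable_const _ _ _ (B.sigmaOf (shorter u.length)) (1 : ℝ≥0∞))
      (B.measurableSet_alive le_rfl)
  have hprod : ∀ u, Measurable[B.sigmaOf (shorter u.length)] fun ω =>
      (B.alive u).indicator (1 : Ω → ℝ≥0∞) ω * expWeight 1 (B.height θ ℓ u ω) := fun u =>
    Measurable.mul (halive u) ((measurable_expWeight 1).comp (B.measurable_height θ ℓ le_rfl))
  have hstep : ∀ u, ∑' j, J (j :: u) = J u * q := by
    intro u
    have key := B.lintegral_mul_tsum_children (s := shorter u.length) (u := u)
      (by simp [shorter]) (hprod u) (B.measurable_height θ ℓ (u := u) le_rfl)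
      (H := fun p => expWeight 1 (θ * p.2 + ℓ)) ((measurable_expWeight 1).comp (by fun_prop))
    rw [lintegral_mul_const' _ _ hqt] at key
    rw [← lintegral_tsum fun j => ((hprod (j :: u)).mono (B.sigmaOf_le _) le_rfl).aemeasurable]
    refine Eq.trans (lintegral_congr fun ω => ?_) key
    rw [← ENNReal.tsum_mul_left]
    refine tsum_congr fun j => ?_
    rw [height_cons, expWeight_add]
    simp only [Set.indicator_apply]
    have hmem : ω ∈ B.alive (j :: u) ↔ ω ∈ B.alive u ∧ j < B.numChildren u ω := Iff.rfl
    rw [hmem]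
    by_cases h1 : ω ∈ B.alive u <;> by_cases h2 : j < B.numChildren u ω <;> simp [h1, h2]
  have hlevel : ∀ n, levelSum n J = q ^ n := by
    intro n
    induction n with
    | zero => rw [levelSum_zero]; simp [hJ, alive, height_nil, expWeight]
    | succ n ih =>
      rw [levelSum_succ]
      simp_rw [hstep]
      rw [levelSum_mul_right, ih, pow_succ]
  have he : ∑' u, ∫⁻ ω, ‖B.generationWeight z n u ω‖ₑ ∂P =
      levelSum n J := by
    unfold levelSum
    refine tsum_congr fun u => ?_
    split_ifs with h
    · refine lintegral_congr fun ω => ?_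
      by_cases ha : ω ∈ B.alive u
      · rw [B.generationWeight_of_mem (B.mem_generation.2 ⟨h, ha⟩), Set.indicator_of_mem ha,
          ← ofReal_norm, B.norm_weight hm]
        simp [expWeight, θ, ℓ]
      · rw [B.generationWeight_of_notMem (fun h' => ha (B.mem_generation.1 h').2),
          Set.indicator_of_notMem ha]
        simp
    · simp [B.generationWeight_of_length_ne h]
  rw [he, hlevel]
  exact ENNReal.pow_ne_top hqt

/-- The martingale property: each fluctuation in generation n is centred and independent of the
earlier generations, which determine its weight and the event s. -/
theorem setIntegral_increment_eq_zero [IsProbabilityMeasure P] {z : ℂ} (hz : z ∈ B.domain)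
    (hm : B.m z ≠ 0) (n : ℕ) {s : Set Ω} (hs : MeasurableSet[B.sigmaOf (shorter n)] s) :
    ∫ ω in s, ∑ u ∈ B.generation n ω, B.weight z u ω * B.fluctuation z u ω ∂P = 0 := by
  classical
  have hs' : MeasurableSet s := B.sigmaOf_le _ s hs
  set w : List ℕ → Ω → ℂ := B.generationWeight z n with hw
  have hwm : ∀ u, Measurable (w u) := fun u =>
    (B.measurable_generationWeight z n u).mono (B.sigmaOf_le _) le_rfl
  have hYm : ∀ u, Measurable (B.fluctuation z u) := fun u =>
    (B.measurable_fluctuation z u).mono (B.measurable_offspring u).comap_le le_rfl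
  have hw0 : ∀ u, u ∈ shorter n → ∀ ω, w u ω = 0 := fun u hu ω =>
    B.generationWeight_of_length_ne (ne_of_lt hu) ω
  have hYc : ∀ u, ∫⁻ ω, ‖B.fluctuation z u ω‖ₑ ∂P = ∫⁻ ω, ‖B.fluctuation z [] ω‖ₑ ∂P := fun u =>
    ((B.identDistrib_fluctuation z u).comp measurable_enorm).lintegral_eq
  have hsum : ∀ ω, ∑ u ∈ B.generation n ω, B.weight z u ω * B.fluctuation z u ω =
      ∑' u, w u ω * B.fluctuation z u ω := by
    intro ω
    rw [tsum_eq_sum (s := B.generation n ω)]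
    · exact Finset.sum_congr rfl fun u hu => by rw [hw, B.generationWeight_of_mem hu]
    · exact fun u hu => by rw [hw, B.generationWeight_of_notMem hu, zero_mul]
  simp_rw [hsum]
  have hfin : ∑' u, ∫⁻ ω in s, ‖w u ω * B.fluctuation z u ω‖ₑ ∂P ≠ ⊤ := by
    have hle : ∑' u, ∫⁻ ω in s, ‖w u ω * B.fluctuation z u ω‖ₑ ∂P ≤
        (∑' u, ∫⁻ ω, ‖w u ω‖ₑ ∂P) * ∫⁻ ω, ‖B.fluctuation z [] ω‖ₑ ∂P := by
      rw [← ENNReal.tsum_mul_right]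
      refine ENNReal.tsum_le_tsum fun u => (setLIntegral_le_lintegral _ _).trans ?_
      by_cases hu : u ∈ shorter n
      · simp [hw0 u hu]
      · simp_rw [enorm_mul]
        rw [← hYc u]
        exact (lintegral_mul_eq_lintegral_mul_lintegral_of_independent_measurableSpace
          (B.sigmaOf_le (shorter n)) (B.measurable_offspring u).comap_le (B.indep_sigmaOf hu)
          (measurable_enorm.comp (B.measurable_generationWeight z n u))
          (measurable_enorm.comp (B.measurable_fluctuation z u))).le
    exact ne_top_of_le_ne_top (ENNReal.mul_ne_top (B.tsum_lintegral_weight_ne_top hz hm n)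
      (B.integrable_fluctuation hz []).2.ne) hle
  have hmeas : ∀ u, AEStronglyMeasurable (fun ω => w u ω * B.fluctuation z u ω) (P.restrict s) :=
    fun u => ((hwm u).mul (hYm u)).aestronglyMeasurable
  rw [integral_tsum hmeas hfin]
  refine (tsum_congr fun u => ?_).trans tsum_zero
  -- Words shorter than n carry zero weight; all others lie outside `shorter n`, so their
  -- fluctuations are independent of its σ-algebra.
  by_cases hu : u ∈ shorter n
  · simp [hw0 u hu]
  · rw [← integral_indicator hs']
    have h1 : Measurable[B.sigmaOf (shorter n)] (s.indicator (w u)) :=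
      Measurable.indicator (B.measurable_generationWeight z n u) hs
    have h2 : IndepFun (s.indicator (w u)) (B.fluctuation z u) P :=
      B.indepFun_sigmaOf hu h1 (B.measurable_fluctuation z u)
    have h3 := h2.integral_mul_eq_mul_integral
      (h1.mono (B.sigmaOf_le _) le_rfl).aestronglyMeasurable (hYm u).aestronglyMeasurable
    rw [B.integral_fluctuation hz hm, mul_zero] at h3
    refine Eq.trans (integral_congr_ae (Eventually.of_forall fun ω => ?_)) h3
    by_cases hω : ω ∈ s <;> simp [hω]

/-- Doob's convergence theorem for real martingales bounded in L^1, to be applied with φ the real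
and the imaginary part. -/
theorem exists_ae_tendsto_clm [IsProbabilityMeasure P] {z : ℂ} (hz : z ∈ B.domain)
    (hm : B.m z ≠ 0) (hint : ∀ n, Integrable (B.additiveMartingale z n) P) {R : NNReal}
    (hR : ∀ n, eLpNorm (B.additiveMartingale z n) 1 P ≤ R) (φ : ℂ →L[ℝ] ℝ)
    (hφ : ∀ w, ‖φ w‖ ≤ ‖w‖) :
    ∃ Z : Ω → ℝ, Measurable Z ∧
      ∀ᵐ ω ∂P, Tendsto (fun n => φ (B.additiveMartingale z n ω)) atTop (𝓝 (Z ω)) := by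
  have hmart : Martingale (fun n ω => φ (B.additiveMartingale z n ω)) B.generationFiltration P := by
    refine martingale_of_setIntegral_eq_succ (fun n => ?_) (fun n => φ.integrable_comp (hint n))
      fun n s hs => ?_
    · exact (φ.continuous.measurable.comp (B.measurable_additiveMartingale z n)).stronglyMeasurable
    · rw [φ.integral_comp_comm (hint n).integrableOn, φ.integral_comp_comm (hint (n + 1)).integrableOn]
      congr 1
      have hd : ∀ ω, ∑ u ∈ B.generation n ω, B.weight z u ω * B.fluctuation z u ω =
          B.additiveMartingale z (n + 1) ω - B.additiveMartingale z n ω := fun ω => by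
        rw [additiveMartingale_succ]; ring
      have h0 := B.setIntegral_increment_eq_zero hz hm n hs
      simp_rw [hd] at h0
      rw [integral_sub (hint (n + 1)).integrableOn (hint n).integrableOn, sub_eq_zero] at h0
      exact h0.symm
  refine ⟨_, (Filtration.stronglyMeasurable_limit_process'
    (ℱ := B.generationFiltration) (f := fun n ω => φ (B.additiveMartingale z n ω))).measurable,
    hmart.submartingale.ae_tendsto_limitProcess (R := R) fun n => le_trans ?_ (hR n)⟩
  exact eLpNorm_mono fun ω => hφ _


/-! ### The tilted law of the increments -/

theorem intensity_univ : B.intensity Set.univ = ∫⁻ ω, ((B.offspring [] ω).1 : ℝ≥0∞) ∂P := by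
  rw [← lintegral_one, ← B.lintegral_tsum_children [] measurable_const]
  refine lintegral_congr fun ω => ?_
  rw [tsum_eq_sum (s := Finset.range (B.offspring [] ω).1)]
  · rw [Finset.sum_congr rfl fun j hj => if_pos (Finset.mem_range.1 hj)]
    simp
  · exact fun j hj => if_neg fun h => hj (Finset.mem_range.2 h)

theorem lintegral_expWeight_eq_one {θ α r : ℝ} (hr : 0 < r) (h : B.mReal (α * θ) / r ^ α = 1) :
    ∫⁻ x, expWeight α (θ * x + Real.log r) ∂B.intensity = 1 := by
  have hrα : 0 < r ^ α := Real.rpow_pos_of_pos hr α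
  have hmr : B.mReal (α * θ) = r ^ α := by
    rwa [div_eq_one_iff_eq hrα.ne'] at h
  -- A divergent integral would have the default value 0, but `mReal` equals r^α > 0 here.
  have hint : Integrable (fun x : ℝ => Real.exp (-(α * θ) * x)) B.intensity := by
    by_contra hn
    have : B.mReal (α * θ) = 0 := integral_undef hn
    exact hrα.ne' (hmr ▸ this)
  have he : ∀ x : ℝ, expWeight α (θ * x + Real.log r) =
      ENNReal.ofReal (Real.exp (-(α * θ) * x)) * ENNReal.ofReal ((r ^ α)⁻¹) := by
    intro x
    unfold expWeight
    rw [← ENNReal.ofReal_mul (Real.exp_nonneg _), ← Real.rpow_neg hr.le, Real.rpow_def_of_pos hr,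
      ← Real.exp_add]
    congr 2
    ring
  simp_rw [he]
  rw [lintegral_mul_const' _ _ ENNReal.ofReal_ne_top, ← ofReal_integral_eq_lintegral_ofReal hint
    (Eventually.of_forall fun x => Real.exp_nonneg _), ← ENNReal.ofReal_mul
    (integral_nonneg fun x => Real.exp_nonneg _)]
  have : ∫ x : ℝ, Real.exp (-(α * θ) * x) ∂B.intensity = r ^ α := hmr
  rw [this, mul_inv_cancel₀ hrα.ne', ENNReal.ofReal_one]

theorem isProbabilityMeasure_tiltedLaw {θ ℓ α : ℝ}
    (h : ∫⁻ x, expWeight α (θ * x + ℓ) ∂B.intensity = 1) :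
    IsProbabilityMeasure (B.tiltedLaw θ ℓ α) := by
  refine ⟨?_⟩
  rw [← lintegral_one, B.lintegral_tiltedLaw _ _ _ measurable_const]
  simpa using h

/-- By supercriticality, the tilted law of the increments is not concentrated at zero. -/
theorem tiltedLaw_singleton_ne_one {θ ℓ α : ℝ}
    (h : ∫⁻ x, expWeight α (θ * x + ℓ) ∂B.intensity = 1) : B.tiltedLaw θ ℓ α {0} ≠ 1 := by
  have := B.isProbabilityMeasure_tiltedLaw h
  intro h1
  rw [← prob_compl_eq_zero_iff (measurableSet_singleton _)] at h1
  have hm : Measurable (({0}ᶜ : Set ℝ).indicator (1 : ℝ → ℝ≥0∞)) :=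
    measurable_one.indicator (measurableSet_singleton _).compl
  have hmη : Measurable fun x : ℝ => θ * x + ℓ := by fun_prop
  have hm' : Measurable fun x : ℝ =>
      expWeight α (θ * x + ℓ) * ({0}ᶜ : Set ℝ).indicator 1 (θ * x + ℓ) :=
    ((measurable_expWeight α).comp hmη).mul (hm.comp hmη)
  rw [← lintegral_indicator_one (measurableSet_singleton _).compl,
    B.lintegral_tiltedLaw _ _ _ hm, lintegral_eq_zero_iff hm'] at h1
  -- The tilting density is positive, so θx + ℓ = 0 for almost every x and the density is 1. The
  -- tilted mass 1 is then the mass E[N] > 1 of the intensity, a contradiction.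
  have h2 : ∀ᵐ x ∂B.intensity, expWeight α (θ * x + ℓ) = 1 := by
    filter_upwards [h1] with x hx
    have hpos : expWeight α (θ * x + ℓ) ≠ 0 := by simp [expWeight, Real.exp_pos]
    by_cases h0 : θ * x + ℓ = 0
    · rw [h0]; simp [expWeight]
    · exfalso
      simp only [Pi.zero_apply] at hx
      rw [Set.indicator_of_mem (by exact h0)] at hx
      simp [hpos] at hx
  rw [lintegral_congr_ae h2, lintegral_one, intensity_univ] at h
  exact absurd h (ne_of_gt B.supercritical)

/-! ### Convergence under a tail bound -/

/-- The tail bound, uniform in n, bounds every moment of order below α; order 1 is among them and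
feeds the martingale convergence theorem. Fatou's lemma carries the moments over to the limit. -/
theorem exists_limit_of_tail [IsProbabilityMeasure P] {z : ℂ} (hz : z ∈ B.domain)
    (hm : B.m z ≠ 0) {α : ℝ} (hα : 1 < α) {C : ℝ≥0∞} (hC : C ≠ ⊤)
    (htail : ∀ T, 0 ≤ T → ∀ n,
      P {ω | Real.exp T ≤ ‖B.additiveMartingale z n ω - 1‖} ≤ C * expWeight α T) :
    ∃ Z : Ω → ℂ, Measurable Z ∧
      (∀ᵐ ω ∂P, Tendsto (fun n => B.additiveMartingale z n ω) atTop (𝓝 (Z ω))) ∧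
      (∀ p : ℝ, 0 < p → p < α →
        (∀ n, MemLp (B.additiveMartingale z n) (ENNReal.ofReal p) P) ∧
        MemLp Z (ENNReal.ofReal p) P ∧
        Tendsto (fun n => eLpNorm (fun ω => B.additiveMartingale z n ω - Z ω)
          (ENNReal.ofReal p) P) atTop (𝓝 0)) ∧
      ∃ C : ℝ, 0 < C ∧ ∀ t : ℝ, 0 < t → P.real {ω | t ≤ ‖Z ω‖} ≤ C * t ^ (-α) := by
  have hMm : ∀ n, Measurable (B.additiveMartingale z n) := fun n =>
    (B.measurable_additiveMartingale z n).mono (B.sigmaOf_le _) le_rfl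
  have hnorm : ∀ {f : Ω → ℂ} {p : ℝ}, 0 < p → eLpNorm f (ENNReal.ofReal p) P =
      (∫⁻ ω, ‖f ω‖ₑ ^ p ∂P) ^ (1 / p) := fun {f p} hp => by
    rw [eLpNorm_eq_lintegral_rpow_enorm_toReal (by simpa using hp) ENNReal.ofReal_ne_top,
      ENNReal.toReal_ofReal hp.le]
  have hmom : ∀ p : ℝ, 0 < p → p < α → ∃ D : ℝ≥0∞, D ≠ ⊤ ∧
      ∀ n, ∫⁻ ω, ‖B.additiveMartingale z n ω - 1‖ₑ ^ p ∂P ≤ D := fun p hp hpα => by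
    obtain ⟨D, hD, h⟩ := exists_lintegral_rpow_le_of_tail hp hpα hC
    exact ⟨D, hD, fun n => h P ((hMm n).sub_const 1) fun T hT => htail T hT n⟩
  have hmemLp : ∀ p : ℝ, 0 < p → p < α → ∀ n,
      MemLp (B.additiveMartingale z n) (ENNReal.ofReal p) P := fun p hp hpα n => by
    obtain ⟨D, hD, h⟩ := hmom p hp hpα
    have h1 : MemLp (fun ω => B.additiveMartingale z n ω - 1) (ENNReal.ofReal p) P := by
      refine ⟨((hMm n).sub_const 1).aestronglyMeasurable, ?_⟩
      rw [hnorm hp]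
      exact ENNReal.rpow_lt_top_of_nonneg (by positivity) (ne_top_of_le_ne_top hD (h n))
    exact (h1.add (memLp_const (1 : ℂ))).ae_eq (Eventually.of_forall fun ω => by simp)
  have hint : ∀ n, Integrable (B.additiveMartingale z n) P := fun n => by
    have := hmemLp 1 one_pos hα n
    rw [ENNReal.ofReal_one] at this
    exact memLp_one_iff_integrable.1 this
  obtain ⟨D₁, hD₁, hb₁⟩ := hmom 1 one_pos hα
  have hR : ∀ n, eLpNorm (B.additiveMartingale z n) 1 P ≤ (D₁.toNNReal + 1 : NNReal) := by
    intro n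
    rw [eLpNorm_one_eq_lintegral_enorm, ENNReal.coe_add, ENNReal.coe_toNNReal hD₁]
    calc ∫⁻ ω, ‖B.additiveMartingale z n ω‖ₑ ∂P
        ≤ ∫⁻ ω, (‖B.additiveMartingale z n ω - 1‖ₑ + 1) ∂P := by
          refine lintegral_mono fun ω => ?_
          have := enorm_add_le (B.additiveMartingale z n ω - 1) 1
          simpa using this
      _ ≤ D₁ + 1 := by
          rw [lintegral_add_right _ measurable_const]
          refine add_le_add ?_ (by simp)
          simpa using hb₁ n
  obtain ⟨Zr, hZrm, hZr⟩ := B.exists_ae_tendsto_clm hz hm hint hR Complex.reCLM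
    fun w => Complex.abs_re_le_norm w
  obtain ⟨Zi, hZim, hZi⟩ := B.exists_ae_tendsto_clm hz hm hint hR Complex.imCLM
    fun w => Complex.abs_im_le_norm w
  set Z : Ω → ℂ := fun ω => (Zr ω : ℂ) + (Zi ω : ℂ) * Complex.I with hZ
  have hZm : Measurable Z := (Complex.measurable_ofReal.comp hZrm).add
    ((Complex.measurable_ofReal.comp hZim).mul measurable_const)
  have hlim : ∀ᵐ ω ∂P, Tendsto (fun n => B.additiveMartingale z n ω) atTop (𝓝 (Z ω)) := by
    filter_upwards [hZr, hZi] with ω h1 h2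
    have h3 := ((Complex.continuous_ofReal.tendsto _).comp h1).add
      (((Complex.continuous_ofReal.tendsto _).comp h2).mul_const Complex.I)
    refine h3.congr fun n => ?_
    simp only [Function.comp_apply, Complex.reCLM_apply, Complex.imCLM_apply]
    exact Complex.re_add_im _
  have hZmom : ∀ p : ℝ, 0 < p → p < α → ∃ D : ℝ≥0∞, D ≠ ⊤ ∧
      (∀ n, ∫⁻ ω, ‖B.additiveMartingale z n ω - 1‖ₑ ^ p ∂P ≤ D) ∧
      ∫⁻ ω, ‖Z ω - 1‖ₑ ^ p ∂P ≤ D := fun p hp hpα => by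
    obtain ⟨D, hD, h⟩ := hmom p hp hpα
    refine ⟨D, hD, h, ?_⟩
    calc ∫⁻ ω, ‖Z ω - 1‖ₑ ^ p ∂P
        = ∫⁻ ω, liminf (fun n => ‖B.additiveMartingale z n ω - 1‖ₑ ^ p) atTop ∂P := by
          refine lintegral_congr_ae ?_
          filter_upwards [hlim] with ω hω
          exact (((hω.sub_const 1).enorm).ennrpow_const p).liminf_eq.symm
      _ ≤ liminf (fun n => ∫⁻ ω, ‖B.additiveMartingale z n ω - 1‖ₑ ^ p ∂P) atTop :=
          lintegral_liminf_le fun n => ((hMm n).sub_const 1).enorm.pow_const p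
      _ ≤ D := liminf_le_of_frequently_le' (Eventually.of_forall h).frequently
  refine ⟨Z, hZm, hlim, fun p hp hpα => ⟨hmemLp p hp hpα, ?_, ?_⟩, ?_⟩
  · obtain ⟨D, hD, _, h⟩ := hZmom p hp hpα
    have h1 : MemLp (fun ω => Z ω - 1) (ENNReal.ofReal p) P := by
      refine ⟨(hZm.sub_const 1).aestronglyMeasurable, ?_⟩
      rw [hnorm hp]
      exact ENNReal.rpow_lt_top_of_nonneg (by positivity) (ne_top_of_le_ne_top hD h)
    exact (h1.add (memLp_const (1 : ℂ))).ae_eq (Eventually.of_forall fun ω => by simp)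
  -- Bounded moments of an order q strictly above p supply the uniform integrability for L^p
  -- convergence.
  · obtain ⟨q, hpq, hqα⟩ := exists_between hpα
    have hq : 0 < q := hp.trans hpq
    obtain ⟨D, hD, hMD, hZD⟩ := hZmom q hq hqα
    have hbound : ∀ n, ∫⁻ ω, ‖B.additiveMartingale z n ω - Z ω‖ₑ ^ q ∂P ≤ 2 ^ q * (D + D) := by
      intro n
      calc ∫⁻ ω, ‖B.additiveMartingale z n ω - Z ω‖ₑ ^ q ∂P
          ≤ ∫⁻ ω, 2 ^ q * (‖B.additiveMartingale z n ω - 1‖ₑ ^ q + ‖Z ω - 1‖ₑ ^ q) ∂P := by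
            refine lintegral_mono fun ω => ?_
            refine le_trans (ENNReal.rpow_le_rpow ?_ hq.le) (enorm_add_rpow_le hq.le _ _)
            rw [← sub_sub_sub_cancel_right _ _ (1 : ℂ)]
            exact enorm_sub_le
        _ = 2 ^ q * (∫⁻ ω, ‖B.additiveMartingale z n ω - 1‖ₑ ^ q ∂P +
              ∫⁻ ω, ‖Z ω - 1‖ₑ ^ q ∂P) := by
            have h1 : Measurable fun ω => ‖B.additiveMartingale z n ω - 1‖ₑ ^ q :=
              ((hMm n).sub_const 1).enorm.pow_const q
            have h2 : Measurable fun ω => ‖Z ω - 1‖ₑ ^ q := (hZm.sub_const 1).enorm.pow_const q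
            rw [← lintegral_add_left h1]
            exact lintegral_const_mul _ (h1.add h2)
        _ ≤ _ := by gcongr; exact hMD n
    have hlim0 : ∀ᵐ ω ∂P, Tendsto (fun n => B.additiveMartingale z n ω - Z ω) atTop (𝓝 0) := by
      filter_upwards [hlim] with ω hω
      simpa using hω.sub_const (Z ω)
    have hfin : (2 : ℝ≥0∞) ^ q * (D + D) ≠ ⊤ :=
      ENNReal.mul_ne_top (ENNReal.rpow_ne_top_of_nonneg hq.le (by norm_num)) (by finiteness)
    have h0 := tendsto_lintegral_rpow_zero (fun n => (hMm n).sub hZm) hlim0 hp hpq hfin hbound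
    have h1 := h0.ennrpow_const (1 / p)
    rw [ENNReal.zero_rpow_of_pos (by positivity)] at h1
    exact h1.congr fun n => (hnorm hp).symm
  -- For t ≥ 4 a modulus of at least t/2 forces a distance of at least t/2 − 1 ≥ t/4 from 1, so the
  -- tail bound applies at level t/4. For t < 4 the summand 1 makes the bound exceed 1.
  · set K : ℝ := (C.toReal + 1) * 4 ^ α with hK
    have h4 : (0 : ℝ) < 4 ^ α := by positivity
    have hC0 : 0 ≤ C.toReal := ENNReal.toReal_nonneg
    refine ⟨K, by positivity, fun t ht => ?_⟩
    have hscale : (4 : ℝ) ^ α * t ^ (-α) = (t / 4) ^ (-α) := by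
      rw [Real.div_rpow ht.le (by norm_num), Real.rpow_neg (by norm_num : (0 : ℝ) ≤ 4)]
      field_simp
    rcases lt_or_ge t 4 with h | h
    · have h1 : (1 : ℝ) ≤ 4 ^ α * t ^ (-α) := by
        rw [hscale]
        exact Real.one_le_rpow_of_pos_of_le_one_of_nonpos (by positivity) (by linarith)
          (by linarith)
      calc P.real {ω | t ≤ ‖Z ω‖} ≤ 1 := measureReal_le_one
        _ ≤ K * t ^ (-α) := by rw [hK, mul_assoc]; nlinarith
    · have hpos : 0 < t / 4 := by positivity
      have hbd : ∀ n, P {ω | t / 2 ≤ ‖B.additiveMartingale z n ω‖} ≤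
          C * ENNReal.ofReal ((t / 4) ^ (-α)) := by
        intro n
        have h1 := htail (Real.log (t / 4)) (Real.log_nonneg (by linarith)) n
        rw [Real.exp_log hpos] at h1
        have h2 : expWeight α (Real.log (t / 4)) = ENNReal.ofReal ((t / 4) ^ (-α)) := by
          unfold expWeight
          rw [Real.rpow_def_of_pos hpos]
          congr 2
          ring
        rw [h2] at h1
        refine (measure_mono fun ω hω => ?_).trans h1
        simp only [Set.mem_ofPred_eq] at hω ⊢
        have := norm_sub_norm_le (B.additiveMartingale z n ω) 1
        rw [norm_one] at this
        linarith
      -- If |Z| ≥ t, then |Z_n| ≥ t/2 or |Z_n − Z| ≥ t/2; the probability of the latter vanishes in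
      -- the limit.
      have hmeas := tendstoInMeasure_iff_norm.1 (tendstoInMeasure_of_tendsto_ae
        (fun n => (hMm n).aestronglyMeasurable) hlim) (t / 2) (by positivity)
      have hle : ∀ n, P {ω | t ≤ ‖Z ω‖} ≤ C * ENNReal.ofReal ((t / 4) ^ (-α)) +
          P {ω | t / 2 ≤ ‖B.additiveMartingale z n ω - Z ω‖} := by
        intro n
        refine le_trans (measure_mono fun ω hω => ?_)
          ((measure_union_le _ _).trans (add_le_add (hbd n) le_rfl))
        simp only [Set.mem_ofPred_eq, Set.mem_union] at hω ⊢
        by_contra! hcon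
        have := norm_sub_norm_le (Z ω) (B.additiveMartingale z n ω)
        rw [norm_sub_rev] at this
        linarith [hcon.1, hcon.2]
      have hfinal : P {ω | t ≤ ‖Z ω‖} ≤ C * ENNReal.ofReal ((t / 4) ^ (-α)) := by
        have hsum := hmeas.const_add (C * ENNReal.ofReal ((t / 4) ^ (-α)))
        rw [add_zero] at hsum
        exact ge_of_tendsto' hsum hle
      have hreal : P.real {ω | t ≤ ‖Z ω‖} ≤ C.toReal * (t / 4) ^ (-α) := by
        have := ENNReal.toReal_mono (ENNReal.mul_ne_top hC ENNReal.ofReal_ne_top) hfinal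
        rwa [ENNReal.toReal_mul, ENNReal.toReal_ofReal (Real.rpow_nonneg hpos.le _)] at this
      refine hreal.trans ?_
      rw [hK, mul_assoc, hscale]
      gcongr
      linarith

end BranchingRandomWalk

end

/- The hypotheses on the derivative of `m` are not needed: the Green function of a nontrivial random
walk killed below zero, integrated against an exponential weight, is bounded for every drift. -/
theorem proposition2p6 {Ω : Type*} [MeasurableSpace Ω] (P : Measure Ω) [IsProbabilityMeasure P]
    (B : BranchingRandomWalk P) (z : ℂ) (hz : z ∈ B.domain)
    (α : ℝ) (hα : α ∈ Set.Ioo (1 : ℝ) 2)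
    (hm : B.mReal (α * z.re) / ‖B.m z‖ ^ α = 1)
    -- `d` is the derivative `m'(αθ)`, one-sided if `αθ` is an endpoint of the real domain of `m`;
    -- for `θ = 0` the product `θ m'(αθ)` is read as `0` and no differentiability is required
    (d : ℝ) (hd : z.re ≠ 0 → HasDerivWithinAt B.mReal d B.realDomain (α * z.re))
    (hm' : z.re * d / ‖B.m z‖ ^ α ≤ Real.log ‖B.m z‖)
    (γ : ℝ) (hγ : γ ∈ Set.Ioc α 2)
    (hmoment : Integrable (fun ω => ‖B.additiveMartingale z 1 ω‖ ^ γ) P) :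
    ∃ Z : Ω → ℂ, Measurable Z ∧
      (∀ᵐ ω ∂P, Tendsto (fun n => B.additiveMartingale z n ω) atTop (𝓝 (Z ω))) ∧
      (∀ p : ℝ, 0 < p → p < α →
        (∀ n, MemLp (B.additiveMartingale z n) (ENNReal.ofReal p) P) ∧
        MemLp Z (ENNReal.ofReal p) P ∧
        Tendsto (fun n => eLpNorm (fun ω => B.additiveMartingale z n ω - Z ω)
          (ENNReal.ofReal p) P) atTop (𝓝 0)) ∧
      ∃ C : ℝ, 0 < C ∧ ∀ t : ℝ, 0 < t → P.real {ω | t ≤ ‖Z ω‖} ≤ C * t ^ (-α) := by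
  -- If m(λ) were 0, the quotient in `hm` would be a division by zero, with value 0 instead of 1.
  have hm0 : B.m z ≠ 0 := by
    intro h
    rw [h, norm_zero, Real.zero_rpow (by linarith [hα.1]), div_zero] at hm
    exact zero_ne_one hm
  have hone := B.lintegral_expWeight_eq_one (norm_pos_iff.2 hm0) hm
  have := B.isProbabilityMeasure_tiltedLaw hone
  have hγ0 : 0 < γ := by linarith [hα.1, hγ.1]
  have hYm : Measurable (B.fluctuation z []) :=
    (B.measurable_fluctuation z []).mono (B.measurable_offspring []).comap_le le_rfl
  have hfun : B.additiveMartingale z 1 = fun ω => B.fluctuation z [] ω + 1 :=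
    funext (B.additiveMartingale_one z)
  have hM : MemLp (B.additiveMartingale z 1) (ENNReal.ofReal γ) P := by
    rw [← integrable_norm_rpow_iff (by rw [hfun]; exact (hYm.add_const 1).aestronglyMeasurable)
      (by simpa using hγ0) ENNReal.ofReal_ne_top, ENNReal.toReal_ofReal hγ0.le]
    exact hmoment
  have hY : MemLp (B.fluctuation z []) (ENNReal.ofReal γ) P := by
    have h := hM.sub (memLp_const (1 : ℂ))
    rw [hfun] at h
    refine h.ae_eq (Eventually.of_forall fun ω => ?_)
    simp
  obtain ⟨C, hC, htail⟩ := B.exists_tail_bound hz hm0 hα.1 hγ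
    (B.tiltedLaw_singleton_ne_one hone) hY
  exact B.exists_limit_of_tail hz hm0 hα.1 hC htail
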